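/- Work over the polynomial ring $\mathbb{C}[\mathbf t]$, $\mathbf t=(t_1,t_2,\dots)$, and let $$J(z)=\sum_{n\ge 1} n t_n z^{n-1}+\sum_{n\ge 1}\frac{\partial}{\partial t_n} z^{-n-1}.$$ For integers $k\ge 1$ and $m$, let $P^{(k)}_m$ be the operator on $\mathbb{C}[\mathbf t]$ defined by $$\sum_{m\in\mathbb Z}P^{(k)}_m z^{-m-k}= \;:\!(\partial_z+J(z))^{k-1}J(z)\!:\,,$$ where $:\ :$ is the normal ordering that moves all derivations $\partial/\partial t_n$ to the right of all multiplications by $t_n$ (this is the case $\rho=0$ of the operators $P^{(k)}_m(\rho)$ with $J(z;\rho)=\sum_{n\ge1}(1-\rho^n)nt_nz^{n-1}+\sum_{n\ge1}\frac{\partial}{\partial t_n}z^{-n-1}$). Let the operators $B_n$, $n\in\mathbb Z$, on $\mathbb{C}[\mathbf t]$ be defined by $$\sum_{n\in\mathbb Z}B_nz^n=\exp\Big(\sum_{n\ge1}t_nz^n\Big)\exp\Big(-\sum_{n\ge1}\frac1n\frac{\partial}{\partial t_n}z^{-n}\Big),$$ and for a finite integer sequence $\lambda=(\lambda_1,\dots,\lambda_l)\in\mathbb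 Z^l$, $l\ge 0$, let $S_\lambda=B_{\lambda_1}\cdots B_{\lambda_l}\cdot 1\in\mathbb{C}[\mathbf t]$ be the Schur function of $\lambda$. For $n\in\mathbb Z$ and an integer $j\ge 0$ put $[n]_j=\prod_{i=0}^{j-1}(n-i)$, with $[n]_0=1$. **Theorem.** For all integers $k\ge1$ and $m$, and all $\lambda=(\lambda_1,\dots,\lambda_l)\in\mathbb Z^l$, $$P^{(k)}_m\cdot S_\lambda=\sum_{i=1}^l k[\lambda_i-m-i]_{k-1}\,S_{\lambda-m\epsilon_i}+\delta_{m,0}[-l]_k\,S_\lambda+\delta_{m<0}\sum_{n=1}^{-m}(-1)^{m-n}k[n-l-1]_{k-1}\,S_{(\lambda,n,1^{-m-n})},$$ where $\lambda-m\epsilon_i=(\lambda_1,\dots,\lambda_i-m,\dots,\lambda_l)$, $\delta_{m<0}$ is $1$ if $m<0$ and $0$ otherwise, $1^j=(1,\dots,1)\in\mathbb Z^j$ and $1^0$ is the empty sequence. -/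

import Mathlib

noncomputable section

namespace WSchur

/-- The polynomial ring `ℂ[t₁, t₂, …]`; the variable `t_n` is `MvPolynomial.X n`, `n : ℕ+`. -/
abbrev TPoly : Type := MvPolynomial ℕ+ ℂ

/-- Normally ordered symbols. With `p_n` a formal commuting variable standing for `∂/∂t_n`, an element
`∑_β c_β(t) p^β` (a power series in the `p_n` whose coefficients are polynomials in the `t_n`)
represents the differential operator `∑_β c_β(t) ∂^β`, all derivations standing on the right. -/
abbrev NSymbol : Type := MvPowerSeries ℕ+ TPoly

/-- Generating series (in `z`, `z⁻¹`) of normally ordered symbols. The coefficient of each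
monomial `p^β` is a Laurent series in `z` over `ℂ[t₁, t₂, …]`. The product of this commutative
ring is the normally ordered product `: :`. -/
abbrev ZSymbol : Type := MvPowerSeries ℕ+ (LaurentSeries TPoly)

instance : LeftCommutative (fun (n : ℕ+) (f : TPoly) => MvPolynomial.pderiv n f) where
  left_comm a b f := by
    have h : ⁅(MvPolynomial.pderiv a : Derivation ℂ TPoly TPoly),
        (MvPolynomial.pderiv b : Derivation ℂ TPoly TPoly)⁆ = 0 := by
      apply MvPolynomial.derivation_ext
      intro i
      rw [Derivation.commutator_apply, MvPolynomial.pderiv_X, MvPolynomial.pderiv_X]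
      simp only [Pi.single_apply, Derivation.zero_apply]
      split_ifs <;> simp
    have h2 := congrArg (fun D : Derivation ℂ TPoly TPoly => D f) h
    simpa only [Derivation.commutator_apply, sub_eq_zero, Derivation.zero_apply] using h2

/-- The iterated partial derivative `∂^β = ∏_n (∂/∂t_n)^{β n}` on `ℂ[t₁, t₂, …]`. -/
def iterPderiv (β : ℕ+ →₀ ℕ) (f : TPoly) : TPoly :=
  Multiset.foldr (fun (n : ℕ+) (g : TPoly) => MvPolynomial.pderiv n g) f (Finsupp.toMultiset β)

theorem foldr_pderiv_add (s : Multiset ℕ+) (f g : TPoly) :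
    Multiset.foldr (fun (n : ℕ+) (h : TPoly) => MvPolynomial.pderiv n h) (f + g) s =
      Multiset.foldr (fun (n : ℕ+) (h : TPoly) => MvPolynomial.pderiv n h) f s +
      Multiset.foldr (fun (n : ℕ+) (h : TPoly) => MvPolynomial.pderiv n h) g s := by
  induction s using Multiset.induction_on with
  | empty => simp
  | cons a s ih => simp [ih]

theorem foldr_pderiv_smul (s : Multiset ℕ+) (c : ℂ) (f : TPoly) :
    Multiset.foldr (fun (n : ℕ+) (h : TPoly) => MvPolynomial.pderiv n h) (c • f) s =
      c • Multiset.foldr (fun (n : ℕ+) (h : TPoly) => MvPolynomial.pderiv n h) f s := by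
  induction s using Multiset.induction_on with
  | empty => simp
  | cons a s ih => simp [ih]

theorem iterPderiv_add (β : ℕ+ →₀ ℕ) (f g : TPoly) :
    iterPderiv β (f + g) = iterPderiv β f + iterPderiv β g :=
  foldr_pderiv_add _ f g

theorem iterPderiv_smul (β : ℕ+ →₀ ℕ) (c : ℂ) (f : TPoly) :
    iterPderiv β (c • f) = c • iterPderiv β f :=
  foldr_pderiv_smul _ c f

theorem foldr_pderiv_monomial (s : Multiset ℕ+) (α : ℕ+ →₀ ℕ) (c : ℂ) :
    ∃ d : ℂ, Multiset.foldr (fun (n : ℕ+) (h : TPoly) => MvPolynomial.pderiv n h)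
        (MvPolynomial.monomial α c) s =
          MvPolynomial.monomial (α - Multiset.toFinsupp s) d ∧
      (d ≠ 0 → Multiset.toFinsupp s ≤ α) := by
  induction s using Multiset.induction_on with
  | empty => exact ⟨c, by simp, by simp⟩
  | cons a s ih =>
    obtain ⟨d, h1, h2⟩ := ih
    refine ⟨d * ((α - Multiset.toFinsupp s) a : ℕ), ?_, ?_⟩
    · rw [Multiset.foldr_cons, h1, MvPolynomial.pderiv_monomial, ← Multiset.singleton_add, map_add,
        Multiset.toFinsupp_singleton, add_comm, tsub_add_eq_tsub_tsub]
    · intro hd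
      have hd1 := left_ne_zero_of_mul hd
      have hd2 : (α - Multiset.toFinsupp s) a ≠ 0 := by
        exact_mod_cast right_ne_zero_of_mul hd
      have hle := h2 hd1
      rw [← Multiset.singleton_add, map_add, Multiset.toFinsupp_singleton]
      intro i
      have := hle i
      rw [Finsupp.add_apply, Finsupp.single_apply]
      rw [Finsupp.tsub_apply] at hd2
      split_ifs with hi
      · subst hi; omega
      · omega

/-- Only finitely many of the derivatives `∂^β f` of a polynomial `f` are nonzero. -/
theorem finite_iterPderiv_ne_zero (f : TPoly) : {β | iterPderiv β f ≠ 0}.Finite := by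
  induction f using MvPolynomial.induction_on' with
  | monomial α c =>
    apply (Set.finite_Iic α).subset
    intro β hβ
    obtain ⟨d, h1, h2⟩ := foldr_pderiv_monomial (Finsupp.toMultiset β) α c
    rw [Finsupp.toMultiset_toFinsupp] at h1 h2
    apply h2
    rintro rfl
    exact hβ (by rw [iterPderiv, h1, map_zero])
  | add f g hf hg =>
    apply (hf.union hg).subset
    intro β hβ
    by_contra hcon
    simp only [Set.mem_union, Set.mem_ofPred_eq, not_or, not_not] at hcon
    exact hβ (by rw [iterPderiv_add, hcon.1, hcon.2, add_zero])

theorem finite_support_symbol (c : NSymbol) (f : TPoly) :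
    (Function.support fun β : ℕ+ →₀ ℕ => MvPowerSeries.coeff β c * iterPderiv β f).Finite :=
  (finite_iterPderiv_ne_zero f).subset fun _ hβ => right_ne_zero_of_mul hβ

/-- The differential operator `f ↦ ∑_β c_β(t) ∂^β f` on `ℂ[t₁, t₂, …]` with normally ordered symbol
`c = ∑_β c_β(t) p^β`; the sum has finitely many nonzero terms for each polynomial `f`. -/
def toOperator (c : NSymbol) : Module.End ℂ TPoly where
  toFun f := ∑ᶠ β : ℕ+ →₀ ℕ, MvPowerSeries.coeff β c * iterPderiv β f
  map_add' f g := by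
    simp only [iterPderiv_add, mul_add]
    exact finsum_add_distrib (finite_support_symbol c f) (finite_support_symbol c g)
  map_smul' a f := by
    simp only [iterPderiv_smul, mul_smul_comm, RingHom.id_apply]
    exact (smul_finsum' a (finite_support_symbol c f)).symm

/-- The coefficient of `z^N` of a generating series of normally ordered symbols. -/
def zCoeff (N : ℤ) (F : ZSymbol) : NSymbol :=
  fun β => (MvPowerSeries.coeff β F).coeff N

/-- The derivation `∂_z` on generating series. -/
def zDeriv (F : ZSymbol) : ZSymbol :=
  fun β => LaurentSeries.derivative TPoly (MvPowerSeries.coeff β F)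

/-- The linear form `∑_{n ≥ 1} a_n p_n`. -/
def linearForm (a : ℕ+ → LaurentSeries TPoly) : ZSymbol :=
  fun β => ∑ n ∈ β.support, if β = Finsupp.single n 1 then a n else 0

/-- The generating series with no `p_n` given by a power series in `z` over `ℂ[t₁, t₂, …]`. -/
def ofPowerSeries (g : PowerSeries TPoly) : ZSymbol :=
  MvPowerSeries.C (HahnSeries.ofPowerSeries ℤ TPoly g)

/-- `J(z; ρ) = ∑_{n ≥ 1} (1 - ρ^n) n t_n z^{n-1} + ∑_{n ≥ 1} (∂/∂t_n) z^{-n-1}`. -/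
def J (ρ : ℂ) : ZSymbol :=
  ofPowerSeries (PowerSeries.mk fun j : ℕ =>
      MvPolynomial.C ((1 - ρ ^ (j + 1)) * ((j + 1 : ℕ) : ℂ)) * MvPolynomial.X j.succPNat) +
    linearForm fun n => HahnSeries.single (-(n : ℤ) - 1) 1

/-- `P^{(k)}(z; ρ) = :(∂_z + J(z; ρ))^{k-1} J(z; ρ):` for `k ≥ 1`. -/
def PSeries (ρ : ℂ) (k : ℕ) : ZSymbol :=
  (fun F : ZSymbol => zDeriv F + J ρ * F)^[k - 1] (J ρ)

/-- The operator `P^{(k)}_m(ρ)`, the coefficient of `z^{-m-k}` in `P^{(k)}(z; ρ)`. -/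
def P (ρ : ℂ) (k : ℕ) (m : ℤ) : Module.End ℂ TPoly :=
  toOperator (zCoeff (-m - k) (PSeries ρ k))

/-- The vertex operator generating series
`B(z) = exp(∑_{n ≥ 1} (1 - ρ^n) t_n z^n) exp(-∑_{n ≥ 1} (1/n) (∂/∂t_n) z^{-n})`. -/
def BSeries (ρ : ℂ) : ZSymbol :=
  ofPowerSeries ((PowerSeries.exp ℂ).subst
      (PowerSeries.X * PowerSeries.mk fun j : ℕ =>
        (MvPolynomial.C (1 - ρ ^ (j + 1)) * MvPolynomial.X j.succPNat : TPoly))) *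
    (PowerSeries.exp (LaurentSeries TPoly)).subst
      (linearForm fun n => HahnSeries.single (-(n : ℤ)) (MvPolynomial.C (-(1 / (n : ℂ)))))

/-- The operator `B_n`, the coefficient of `z^n` in `B(z)`. -/
def B (ρ : ℂ) (n : ℤ) : Module.End ℂ TPoly :=
  toOperator (zCoeff n (BSeries ρ))

/-- The Hall-Littlewood function `H_λ(t; ρ) = B_{λ_1} ⋯ B_{λ_l} · 1` of a finite integer sequence. -/
def hallLittlewood (ρ : ℂ) (lam : List ℤ) : TPoly :=
  lam.foldr (fun n f => B ρ n f) 1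

/-- The Schur function `S_λ(t) = H_λ(t; 0)` of a finite integer sequence. -/
def schur (lam : List ℤ) : TPoly :=
  hallLittlewood 0 lam

/-- The falling factorial `[n]_k = ∏_{j=0}^{k-1} (n - j)` of an integer `n`. -/
def fallingFactorial (n : ℤ) (k : ℕ) : ℤ :=
  ∏ j ∈ Finset.range k, (n - (j : ℤ))

end WSchur

end

/-! Conjugation by a power of `z` turns `∂_z + J` into `∂_z + J + a z⁻¹`, so the operators
`P^{(k)}_m` sit in a family `P_{a,m}` (`chargedP k a m`) with an integer charge `a`. Let `α_r` be
`∂/∂t_r` for `r > 0` and multiplication by `-r t_{-r}` for `r < 0`. The charge makes the family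
closed under commutators: `[α_r, P_{a,m}] = P_{a+r,m+r} - P_{a,m+r}`, while `[α_r, B_n] = B_{n-r}`.

The heart is the relation `P_{a,m} B_n = B_n P_{a-1,m} + k[n-m+a-1]_{k-1} B_{n-m}` (`chargedP_B`).
The defects of this relation span a space of operators stable under commutation with every `α_r`. By
a Taylor expansion argument such a space is zero as soon as the vacuum expectation, the constant
term of `X · 1`, vanishes for all its elements `X` (`operator_eq_zero`). The expectations of `P B`
and `B P` follow from Euler's identity for weighted homogeneous polynomials and a telescoping
recursion (`eq_sub_of_recursion`).

Moving `P_{0,m}` through `B_{λ_1} ⋯ B_{λ_l}` lowers the charge by one at each factor; this produces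
the sum over `i` and leaves `P_{-l,m} · 1`. That vector is `0` for `m > 0` and `[-l]_k` for `m = 0`.
For `m = -N < 0` it is `∑_j [j-l]_k (-1)^{N-j} e_{N-j} h_j`, which Pieri's rule and summation by
parts turn into the stated sum over hooks (`chargedP_one_eq_sum`). -/

noncomputable section

/-! ### Derivations of series rings and the chain rule for `exp` -/

namespace MvPowerSeries

variable {σ A R : Type*} [CommRing A] [CommRing R] [Algebra A R]

/-- The coefficientwise extension of a derivation to multivariate power series. -/
def mapDerivation (D : Derivation A R R) :
    Derivation A (MvPowerSeries σ R) (MvPowerSeries σ R) :=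
  Derivation.mk'
    { toFun := fun F β => D (coeff β F)
      map_add' := fun F G => by
        ext β
        change D (coeff β (F + G)) = D (coeff β F) + D (coeff β G)
        simp
      map_smul' := fun c F => by
        ext β
        change D (coeff β (c • F)) = c • D (coeff β F)
        rw [show coeff β (c • F) = c • coeff β F from rfl, D.map_smul] }
    (fun F G => by
      classical
      ext β
      change D (coeff β (F * G)) = coeff β (F * _ + G * _)
      rw [mul_comm G, map_add, coeff_mul, coeff_mul, coeff_mul, map_sum, ← Finset.sum_add_distrib]
      refine Finset.sum_congr rfl fun p _ => ?_
      rw [Derivation.leibniz, smul_eq_mul, smul_eq_mul, mul_comm (coeff p.2 G)]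
      rfl)

@[simp]
theorem coeff_mapDerivation (D : Derivation A R R) (F : MvPowerSeries σ R) (β : σ →₀ ℕ) :
    coeff β (mapDerivation D F) = D (coeff β F) := rfl

end MvPowerSeries

namespace HahnSeries

variable {Γ A R : Type*} [AddCommMonoid Γ] [PartialOrder Γ] [IsOrderedCancelAddMonoid Γ]
  [CommRing A] [CommRing R] [Algebra A R]

/-- The coefficientwise extension of a derivation to Hahn series. -/
def mapDerivation (D : Derivation A R R) : Derivation A (HahnSeries Γ R) (HahnSeries Γ R) :=
  Derivation.mk'
    { toFun := fun x => x.map D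
      map_add' := fun x y => by ext; simp
      map_smul' := fun c x => by ext; simp }
    (fun x y => by
      ext n
      have hx : (x.map D).support ⊆ x.support := fun i hi h => hi (by simp [h])
      have hy : (y.map D).support ⊆ y.support := fun i hi h => hi (by simp [h])
      change D ((x * y).coeff n) = (x * y.map D + y * x.map D).coeff n
      rw [mul_comm y, coeff_add, coeff_mul, coeff_mul_right' y.isPWO_support hy,
        coeff_mul_left' x.isPWO_support hx, map_sum, ← Finset.sum_add_distrib]
      refine Finset.sum_congr rfl fun p _ => ?_
      rw [Derivation.leibniz, smul_eq_mul, smul_eq_mul, mul_comm (y.coeff p.2)]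
      rfl)

@[simp]
theorem coeff_mapDerivation (D : Derivation A R R) (x : HahnSeries Γ R) (n : Γ) :
    (mapDerivation D x).coeff n = D (x.coeff n) := rfl

end HahnSeries

namespace PowerSeries

variable {τ R S : Type*} [CommRing R] [CommRing S] [Algebra R S]

theorem coeff_subst_eq_coeff_sum {a : MvPowerSeries τ S} (ha : a.constantCoeff = 0)
    (f : PowerSeries R) {e : τ →₀ ℕ} {N : ℕ} (hN : e.degree < N) :
    MvPowerSeries.coeff e (f.subst a) =
      MvPowerSeries.coeff e (∑ d ∈ Finset.range N, coeff d f • a ^ d) := by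
  rw [coeff_subst (HasSubst.of_constantCoeff_zero ha), map_sum,
    finsum_eq_sum_of_support_subset (s := Finset.range N)]
  · rfl
  · intro d hd
    by_contra h
    apply hd
    have h' : N ≤ d := by simpa using h
    change coeff d f • MvPowerSeries.coeff e (a ^ d) = 0
    rw [MvPowerSeries.coeff_eq_zero_of_constantCoeff_nilpotent (m := 1) (by rw [ha, pow_one])
      (by omega), smul_zero]

/-- The chain rule `D (exp a) = D a * exp a`, for a derivation `D` of a ring of power series for
which every coefficient of `D F` depends additively on a single coefficient of `F`. -/
theorem derivation_exp_subst {A : Type*} [CommRing A] [Algebra A S] [Algebra ℚ R]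
    (D : Derivation A (MvPowerSeries τ S) (MvPowerSeries τ S))
    (hD : ∀ e, ∃ (e' : τ →₀ ℕ) (φ : S →+ S), ∀ F : MvPowerSeries τ S,
      MvPowerSeries.coeff e (D F) = φ (MvPowerSeries.coeff e' F))
    {a : MvPowerSeries τ S} (ha : a.constantCoeff = 0) :
    D ((exp R).subst a) = D a * (exp R).subst a := by
  classical
  let _ : Algebra ℚ S := ((algebraMap R S).comp (algebraMap ℚ R)).toAlgebra
  have hc (d : ℕ) (F : MvPowerSeries τ S) :
      coeff d (exp R) • F = (1 / (d.factorial : ℚ)) • F := by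
    rw [coeff_exp]
    ext e
    change (algebraMap ℚ R _) • MvPowerSeries.coeff e F =
      (1 / (d.factorial : ℚ)) • MvPowerSeries.coeff e F
    rw [Algebra.smul_def, Algebra.smul_def]
    rfl
  have hsum (N : ℕ) : D (∑ d ∈ Finset.range (N + 1), coeff d (exp R) • a ^ d) =
      D a * ∑ d ∈ Finset.range N, coeff d (exp R) • a ^ d := by
    simp only [hc]
    rw [map_sum, Finset.sum_range_succ', Finset.mul_sum]
    have h0 : D ((1 / ((0 : ℕ).factorial : ℚ)) • a ^ 0) = 0 := by
      simp
    rw [h0, add_zero]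
    refine Finset.sum_congr rfl fun d _ => ?_
    have h1 := map_rat_smul D (1 / ((d + 1).factorial : ℚ)) (a ^ (d + 1))
    rw [h1, Derivation.leibniz_pow, Nat.add_sub_cancel, ← Nat.cast_smul_eq_nsmul ℚ, smul_smul,
      Nat.factorial_succ, smul_eq_mul, mul_smul_comm, mul_comm (D a)]
    congr 1
    push_cast
    have : (d.factorial : ℚ) ≠ 0 := by positivity
    field_simp
  ext e
  obtain ⟨e', φ, h⟩ := hD e
  -- `D` may raise or lower degrees, so the truncation order exceeds both degrees; the exponential
  -- can then be replaced by a polynomial on both sides. The extra 1 pays for the term lost on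
  -- differentiating.
  have hN1 : e'.degree < e.degree + e'.degree + 1 + 1 := by omega
  rw [h, coeff_subst_eq_coeff_sum ha _ hN1, ← h, hsum, MvPowerSeries.coeff_mul,
    MvPowerSeries.coeff_mul]
  refine Finset.sum_congr rfl fun p hp => ?_
  rw [coeff_subst_eq_coeff_sum ha (exp R) (e := p.2) (N := e.degree + e'.degree + 1)]
  have := congrArg Finsupp.degree (Finset.HasAntidiagonal.mem_antidiagonal.1 hp)
  rw [map_add] at this
  omega

end PowerSeries

/-! ### Normally ordered operators and their commutators with `t_r` and `∂/∂t_r` -/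

namespace WSchur

/-- Of the two `ℂ`-algebra structures that instance search can find on Laurent series, the one
compatible with the coefficientwise scalar multiplication. -/
instance laurentAlgebra : Algebra ℂ (LaurentSeries TPoly) := HahnSeries.instAlgebra

theorem iterPderiv_zero (f : TPoly) : iterPderiv 0 f = f := by simp [iterPderiv]

theorem iterPderiv_add_single (β : ℕ+ →₀ ℕ) (r : ℕ+) (f : TPoly) :
    iterPderiv (β + Finsupp.single r 1) f = MvPolynomial.pderiv r (iterPderiv β f) := by
  rw [iterPderiv, add_comm, map_add, Finsupp.toMultiset_single, one_smul, Multiset.singleton_add,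
    Multiset.foldr_cons, iterPderiv]

theorem iterPderiv_zero_right (β : ℕ+ →₀ ℕ) : iterPderiv β 0 = 0 := by
  simpa using iterPderiv_smul β 0 0

theorem foldr_pderiv_pderiv (s : Multiset ℕ+) (r : ℕ+) (f : TPoly) :
    Multiset.foldr (fun (n : ℕ+) (g : TPoly) => MvPolynomial.pderiv n g)
      (MvPolynomial.pderiv r f) s =
    MvPolynomial.pderiv r
      (Multiset.foldr (fun (n : ℕ+) (g : TPoly) => MvPolynomial.pderiv n g) f s) := by
  induction s using Multiset.induction_on with
  | empty => simp
  | cons a s ih =>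
    rw [Multiset.foldr_cons, ih, Multiset.foldr_cons]
    exact LeftCommutative.left_comm (op := fun (n : ℕ+) (g : TPoly) => MvPolynomial.pderiv n g)
      a r _

theorem iterPderiv_pderiv (β : ℕ+ →₀ ℕ) (r : ℕ+) (f : TPoly) :
    iterPderiv β (MvPolynomial.pderiv r f) = MvPolynomial.pderiv r (iterPderiv β f) :=
  foldr_pderiv_pderiv _ r f

theorem iterPderiv_one {β : ℕ+ →₀ ℕ} (hβ : β ≠ 0) : iterPderiv β 1 = 0 := by
  obtain ⟨r, hr⟩ := Finsupp.ne_iff.1 hβ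
  have h : β - Finsupp.single r 1 + Finsupp.single r 1 = β :=
    tsub_add_cancel_of_le (by simpa [Nat.one_le_iff_ne_zero] using hr)
  rw [← h, iterPderiv_add_single, ← iterPderiv_pderiv, MvPolynomial.pderiv_one,
    iterPderiv_zero_right]

theorem foldr_pderiv_X_mul (s : Multiset ℕ+) (r : ℕ+) (f : TPoly) :
    Multiset.foldr (fun (n : ℕ+) (g : TPoly) => MvPolynomial.pderiv n g)
      (MvPolynomial.X r * f) s =
    MvPolynomial.X r *
        Multiset.foldr (fun (n : ℕ+) (g : TPoly) => MvPolynomial.pderiv n g) f s +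
      s.count r •
        Multiset.foldr (fun (n : ℕ+) (g : TPoly) => MvPolynomial.pderiv n g) f (s.erase r) := by
  induction s using Multiset.induction_on with
  | empty => simp
  | cons a s ih =>
    rw [Multiset.foldr_cons, ih, map_add, Derivation.leibniz, map_nsmul, Multiset.foldr_cons,
      smul_eq_mul, smul_eq_mul, add_assoc]
    congr 1
    by_cases h : a = r
    · subst h
      rw [MvPolynomial.pderiv_X_self, mul_one, Multiset.count_cons_self, Multiset.erase_cons_head,
        succ_nsmul, add_comm]
      congr 1
      by_cases hs : a ∈ s
      · rw [← Multiset.foldr_cons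
          (fun (n : ℕ+) (g : TPoly) => MvPolynomial.pderiv n g), Multiset.cons_erase hs]
      · rw [Multiset.count_eq_zero_of_notMem hs, zero_smul, zero_smul]
    · rw [MvPolynomial.pderiv_X_of_ne (Ne.symm h), mul_zero, zero_add,
        Multiset.count_cons_of_ne (Ne.symm h), Multiset.erase_cons_tail _ h, Multiset.foldr_cons]

theorem iterPderiv_X_mul (β : ℕ+ →₀ ℕ) (r : ℕ+) (f : TPoly) :
    iterPderiv β (MvPolynomial.X r * f) =
      MvPolynomial.X r * iterPderiv β f + β r • iterPderiv (β - Finsupp.single r 1) f := by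
  rw [iterPderiv, foldr_pderiv_X_mul, Finsupp.count_toMultiset, iterPderiv, iterPderiv]
  congr 4
  ext n
  rw [Finsupp.count_toMultiset, Finsupp.tsub_apply, Finsupp.single_apply]
  split_ifs with h
  · subst h; rw [Multiset.count_erase_self, Finsupp.count_toMultiset]
  · rw [Multiset.count_erase_of_ne (Ne.symm h), Finsupp.count_toMultiset, Nat.sub_zero]

theorem toOperator_apply (c : NSymbol) (f : TPoly) :
    toOperator c f = ∑ᶠ β : ℕ+ →₀ ℕ, MvPowerSeries.coeff β c * iterPderiv β f := rfl

theorem toOperator_one (c : NSymbol) : toOperator c 1 = MvPowerSeries.coeff 0 c := by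
  rw [toOperator_apply, finsum_eq_single _ 0, iterPderiv_zero, mul_one]
  intro β hβ
  rw [iterPderiv_one hβ, mul_zero]

/-- Leibniz' rule gives `[∂^β, t_r] = β_r ∂^{β-ε_r}`, so commuting with `t_r` amounts to
differentiating the symbol in `p_r`. -/
theorem toOperator_X_mul (c : NSymbol) (r : ℕ+) (f : TPoly) :
    toOperator c (MvPolynomial.X r * f) =
      MvPolynomial.X r * toOperator c f + toOperator (MvPowerSeries.pderiv TPoly r c) f := by
  have hinj : Function.Injective fun γ : ℕ+ →₀ ℕ => γ + Finsupp.single r 1 :=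
    add_left_injective _
  have key : toOperator (MvPowerSeries.pderiv TPoly r c) f =
      ∑ᶠ β : ℕ+ →₀ ℕ,
        MvPowerSeries.coeff β c * (β r • iterPderiv (β - Finsupp.single r 1) f) := by
    rw [toOperator_apply, ← finsum_mem_univ (f := fun β : ℕ+ →₀ ℕ =>
        MvPowerSeries.coeff β c * (β r • iterPderiv (β - Finsupp.single r 1) f)),
      -- Terms with `β r = 0` vanish, so the sum may be reindexed by `β = γ + ε_r`.
      ← finsum_mem_inter_support_eq' _ (Set.range fun γ : ℕ+ →₀ ℕ => γ + Finsupp.single r 1)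
        Set.univ, finsum_mem_range hinj]
    · refine finsum_congr fun γ => ?_
      rw [MvPowerSeries.coeff_pderiv, Finsupp.add_apply, Finsupp.single_eq_same,
        add_tsub_cancel_right, nsmul_eq_mul, mul_assoc]
      push_cast
      rfl
    · intro β hβ
      simp only [Set.mem_univ, iff_true]
      refine ⟨β - Finsupp.single r 1, tsub_add_cancel_of_le ?_⟩
      have : β r ≠ 0 := fun h => hβ (by simp [h])
      simpa [Nat.one_le_iff_ne_zero] using this
  have hfin : (Function.support fun β : ℕ+ →₀ ℕ =>
      MvPowerSeries.coeff β c * (β r • iterPderiv (β - Finsupp.single r 1) f)).Finite := by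
    refine ((finite_iterPderiv_ne_zero f).image fun γ => γ + Finsupp.single r 1).subset ?_
    intro β hβ
    have h0 : β r ≠ 0 := fun h => hβ (by simp [h])
    refine ⟨β - Finsupp.single r 1, fun h => hβ ?_, tsub_add_cancel_of_le ?_⟩
    · change MvPowerSeries.coeff β c * (β r • iterPderiv (β - Finsupp.single r 1) f) = 0
      rw [h, smul_zero, mul_zero]
    · simpa [Nat.one_le_iff_ne_zero] using h0
  have hfin2 : (Function.support fun β : ℕ+ →₀ ℕ =>
      MvPolynomial.X r * (MvPowerSeries.coeff β c * iterPderiv β f)).Finite :=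
    (finite_support_symbol c f).subset fun _ h => right_ne_zero_of_mul h
  rw [key, toOperator_apply, toOperator_apply, mul_finsum' _ _ (finite_support_symbol c f),
    ← finsum_add_distrib hfin2 hfin]
  refine finsum_congr fun β => ?_
  rw [iterPderiv_X_mul]
  ring

theorem pderiv_toOperator (c : NSymbol) (r : ℕ+) (f : TPoly) :
    MvPolynomial.pderiv r (toOperator c f) =
      toOperator c (MvPolynomial.pderiv r f) +
        toOperator (MvPowerSeries.mapDerivation (MvPolynomial.pderiv r) c) f := by
  rw [toOperator_apply, toOperator_apply, toOperator_apply,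
    ← finsum_add_distrib (finite_support_symbol _ _) (finite_support_symbol _ _)]
  have := AddMonoidHom.map_finsum
    (MvPolynomial.pderiv r : Derivation ℂ TPoly TPoly).toLinearMap.toAddMonoidHom
    (finite_support_symbol c f)
  refine this.trans (finsum_congr fun β => ?_)
  change MvPolynomial.pderiv r _ = _
  rw [Derivation.leibniz, iterPderiv_pderiv, MvPowerSeries.coeff_mapDerivation, smul_eq_mul,
    smul_eq_mul, mul_comm (iterPderiv β f)]

theorem toOperator_add (c d : NSymbol) : toOperator (c + d) = toOperator c + toOperator d := by
  refine LinearMap.ext fun f => ?_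
  rw [LinearMap.add_apply, toOperator_apply, toOperator_apply, toOperator_apply,
    ← finsum_add_distrib (finite_support_symbol _ _) (finite_support_symbol _ _)]
  simp only [map_add, add_mul]

theorem toOperator_smul (a : ℂ) (c : NSymbol) : toOperator (a • c) = a • toOperator c := by
  refine LinearMap.ext fun f => ?_
  rw [LinearMap.smul_apply, toOperator_apply, toOperator_apply,
    smul_finsum' a (finite_support_symbol c f)]
  refine finsum_congr fun β => ?_
  rw [← smul_mul_assoc]
  rfl

/-- The operator whose normally ordered symbol is the coefficient of `z^N` in a generating
series, as a linear function of the series. -/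
def coeffOperator (N : ℤ) : ZSymbol →ₗ[ℂ] Module.End ℂ TPoly where
  toFun F := toOperator (zCoeff N F)
  map_add' F G := toOperator_add (zCoeff N F) (zCoeff N G)
  map_smul' a F := toOperator_smul a (zCoeff N F)

theorem coeffOperator_apply (N : ℤ) (F : ZSymbol) :
    coeffOperator N F = toOperator (zCoeff N F) := rfl

theorem coeffOperator_one (N : ℤ) (F : ZSymbol) :
    coeffOperator N F 1 = (MvPowerSeries.coeff 0 F).coeff N :=
  toOperator_one _

/-- The derivation `∂/∂t_r` of generating series. -/
def tDeriv (r : ℕ+) : Derivation ℂ ZSymbol ZSymbol :=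
  MvPowerSeries.mapDerivation (HahnSeries.mapDerivation (MvPolynomial.pderiv r))

/-- The derivation `∂/∂p_r` of generating series. -/
def pDeriv (r : ℕ+) : Derivation ℂ ZSymbol ZSymbol :=
  (MvPowerSeries.pderiv (LaurentSeries TPoly) r).restrictScalars ℂ

theorem coeff_tDeriv (r : ℕ+) (F : ZSymbol) (β : ℕ+ →₀ ℕ) :
    MvPowerSeries.coeff β (tDeriv r F) =
      HahnSeries.mapDerivation (MvPolynomial.pderiv r) (MvPowerSeries.coeff β F) := rfl

theorem coeff_pDeriv (r : ℕ+) (F : ZSymbol) (β : ℕ+ →₀ ℕ) :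
    MvPowerSeries.coeff β (pDeriv r F) =
      MvPowerSeries.coeff (β + Finsupp.single r 1) F * ((β r : LaurentSeries TPoly) + 1) :=
  MvPowerSeries.coeff_pderiv _ _

theorem pderiv_coeffOperator (N : ℤ) (F : ZSymbol) (r : ℕ+) (f : TPoly) :
    MvPolynomial.pderiv r (coeffOperator N F f) =
      coeffOperator N F (MvPolynomial.pderiv r f) + coeffOperator N (tDeriv r F) f :=
  pderiv_toOperator _ r f

theorem coeffOperator_X_mul (N : ℤ) (F : ZSymbol) (r : ℕ+) (f : TPoly) :
    coeffOperator N F (MvPolynomial.X r * f) =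
      MvPolynomial.X r * coeffOperator N F f + coeffOperator N (pDeriv r F) f := by
  have h : zCoeff N (pDeriv r F) = MvPowerSeries.pderiv TPoly r (zCoeff N F) := by
    ext1 β
    rw [MvPowerSeries.coeff_pderiv]
    change (MvPowerSeries.coeff β (pDeriv r F)).coeff N = _
    rw [coeff_pDeriv, ← Nat.cast_succ, mul_comm, ← nsmul_eq_mul, HahnSeries.coeff_nsmul,
      Pi.smul_apply, nsmul_eq_mul, mul_comm, Nat.cast_succ]
    rfl
  rw [coeffOperator_apply, toOperator_X_mul, coeffOperator_apply, h]

/-! ### Powers of `z` and the derivation `∂_z` -/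

/-- The generating series `z^j`. -/
def zPow (j : ℤ) : ZSymbol := MvPowerSeries.C (HahnSeries.single j 1)

theorem coeff_zPow_mul (j : ℤ) (F : ZSymbol) (β : ℕ+ →₀ ℕ) :
    MvPowerSeries.coeff β (zPow j * F) = HahnSeries.single j 1 * MvPowerSeries.coeff β F :=
  MvPowerSeries.coeff_C_mul _ _ _

theorem zPow_mul_zPow (i j : ℤ) : zPow i * zPow j = zPow (i + j) := by
  rw [zPow, zPow, ← map_mul, HahnSeries.single_mul_single, one_mul, zPow]

theorem coeffOperator_zPow_mul (N j : ℤ) (F : ZSymbol) :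
    coeffOperator N (zPow j * F) = coeffOperator (N - j) F := by
  rw [coeffOperator_apply, coeffOperator_apply]
  congr 1
  ext1 β
  change (MvPowerSeries.coeff β (zPow j * F)).coeff N = (MvPowerSeries.coeff β F).coeff (N - j)
  rw [coeff_zPow_mul]
  have := HahnSeries.coeff_single_mul_add (r := (1 : TPoly)) (x := MvPowerSeries.coeff β F)
    (a := N - j) (b := j)
  rwa [sub_add_cancel, one_mul] at this

theorem tDeriv_zPow (r : ℕ+) (j : ℤ) : tDeriv r (zPow j) = 0 := by
  ext1 β
  rw [coeff_tDeriv, zPow, MvPowerSeries.coeff_C]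
  split_ifs
  · refine HahnSeries.ext (funext fun n => ?_)
    rw [HahnSeries.coeff_mapDerivation, HahnSeries.coeff_single]
    split_ifs <;> simp
  · rw [map_zero, map_zero]

theorem pDeriv_zPow (r : ℕ+) (j : ℤ) : pDeriv r (zPow j) = 0 :=
  MvPowerSeries.pderiv_C

theorem coeff_zDeriv (F : ZSymbol) (β : ℕ+ →₀ ℕ) :
    MvPowerSeries.coeff β (zDeriv F) =
      LaurentSeries.derivative TPoly (MvPowerSeries.coeff β F) := rfl

theorem coeff_derivative (x : LaurentSeries TPoly) (n : ℤ) :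
    (LaurentSeries.derivative TPoly x).coeff n = (n + 1 : ℤ) • x.coeff (n + 1) := by
  rw [LaurentSeries.derivative_apply, LaurentSeries.hasseDeriv_coeff]
  simp

theorem zDeriv_add (F G : ZSymbol) : zDeriv (F + G) = zDeriv F + zDeriv G := by
  ext1 β
  rw [map_add, coeff_zDeriv, coeff_zDeriv, coeff_zDeriv, map_add, map_add]

theorem tDeriv_zDeriv (r : ℕ+) (F : ZSymbol) : tDeriv r (zDeriv F) = zDeriv (tDeriv r F) := by
  ext1 β
  refine HahnSeries.ext (funext fun n => ?_)
  rw [coeff_tDeriv, HahnSeries.coeff_mapDerivation, coeff_zDeriv, coeff_zDeriv, coeff_derivative,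
    coeff_derivative, coeff_tDeriv, HahnSeries.coeff_mapDerivation, map_zsmul]

theorem pDeriv_zDeriv (r : ℕ+) (F : ZSymbol) : pDeriv r (zDeriv F) = zDeriv (pDeriv r F) := by
  ext1 β
  rw [coeff_pDeriv, coeff_zDeriv, coeff_zDeriv, coeff_pDeriv, ← Nat.cast_succ, mul_comm,
    ← nsmul_eq_mul, mul_comm, ← nsmul_eq_mul, map_nsmul]

theorem zDeriv_zPow_mul (j : ℤ) (F : ZSymbol) :
    zDeriv (zPow j * F) = zPow j * zDeriv F + j • (zPow (j - 1) * F) := by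
  ext1 β
  refine HahnSeries.ext (funext fun n => ?_)
  have h (i : ℤ) (x : LaurentSeries TPoly) (m : ℤ) :
      (HahnSeries.single i (1 : TPoly) * x).coeff m = x.coeff (m - i) := by
    have := HahnSeries.coeff_single_mul_add (r := (1 : TPoly)) (x := x) (a := m - i) (b := i)
    rwa [sub_add_cancel, one_mul] at this
  have hz (i : ℤ) (x : LaurentSeries TPoly) : (i • x).coeff n = i • x.coeff n :=
    map_zsmul (HahnSeries.coeff.addMonoidHom n) i x
  rw [map_add, map_zsmul, HahnSeries.coeff_add, hz,
    coeff_zDeriv, coeff_derivative, coeff_zPow_mul, coeff_zPow_mul, coeff_zPow_mul, coeff_zDeriv,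
    h, h, h, coeff_derivative, sub_sub_eq_add_sub, show n + 1 - j = n - j + 1 by ring, ← add_smul]
  congr 1
  ring

/-! ### Charged generating series -/

/-- The operation `F ↦ (∂_z + J(z) + a z⁻¹) F` on generating series, for `ρ = 0`. -/
def chargedStep (a : ℤ) (F : ZSymbol) : ZSymbol := zDeriv F + (J 0 + a • zPow (-1)) * F

/-- The generating series `:(∂_z + J(z) + a z⁻¹)^k 1:`, for `ρ = 0`. -/
def chargedSeries (a : ℤ) (k : ℕ) : ZSymbol := (chargedStep a)^[k] 1

theorem chargedSeries_succ (a : ℤ) (k : ℕ) :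
    chargedSeries a (k + 1) = chargedStep a (chargedSeries a k) :=
  Function.iterate_succ_apply' _ _ _

theorem zDeriv_one : zDeriv 1 = 0 := by
  ext1 β
  rw [coeff_zDeriv, MvPowerSeries.coeff_one]
  split_ifs
  · refine HahnSeries.ext (funext fun n => ?_)
    rw [coeff_derivative, HahnSeries.coeff_one]
    split_ifs with hn
    · simp [hn]
    · simp
  · simp

theorem PSeries_eq_chargedSeries {k : ℕ} (hk : 1 ≤ k) : PSeries 0 k = chargedSeries 0 k := by
  obtain ⟨k, rfl⟩ := Nat.exists_eq_add_of_le' hk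
  have h : chargedStep 0 = fun F : ZSymbol => zDeriv F + J 0 * F := by
    funext F
    rw [chargedStep, zero_zsmul, add_zero]
  rw [PSeries, chargedSeries, Function.iterate_succ_apply, Nat.add_sub_cancel, h]
  simp only [zDeriv_one, zero_add, mul_one]

theorem chargedStep_add (a : ℤ) (F G : ZSymbol) :
    chargedStep a (F + G) = chargedStep a F + chargedStep a G := by
  rw [chargedStep, chargedStep, chargedStep, zDeriv_add]
  ring

theorem chargedStep_zPow_mul (a r : ℤ) (F : ZSymbol) :
    chargedStep a (zPow r * F) = zPow r * chargedStep (a + r) F := by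
  have h := zPow_mul_zPow r (-1)
  rw [chargedStep, chargedStep, zDeriv_zPow_mul, sub_eq_add_neg r 1, ← h]
  simp only [zsmul_eq_mul]
  push_cast
  ring

/-- With `D_a = ∂_z + J + a z⁻¹`, the hypotheses say `[δ, D_a] = r z^{r-1} = [D_a, z^r]`, so `δ +
z^r` commutes with `D_a`. Applying this to `D_a^k 1` and using `D_a z^r = z^r D_{a+r}` gives the
formula. One statement covers `∂/∂t_r` and the multiples of `∂/∂p_{-r}`. -/
theorem derivation_chargedSeries (δ : Derivation ℂ ZSymbol ZSymbol) (r : ℤ)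
    (hδ : ∀ F, δ (zDeriv F) = zDeriv (δ F)) (hz : ∀ j, δ (zPow j) = 0)
    (hJ : δ (J 0) = r • zPow (r - 1)) (a : ℤ) (k : ℕ) :
    δ (chargedSeries a k) = zPow r * (chargedSeries (a + r) k - chargedSeries a k) := by
  induction k with
  | zero => simp [chargedSeries]
  | succ k ih =>
    have h1 : δ (chargedStep a (chargedSeries a k)) =
        chargedStep a (δ (chargedSeries a k)) + r • (zPow (r - 1) * chargedSeries a k) := by
      rw [chargedStep, map_add, hδ, Derivation.leibniz, map_add, hJ, map_zsmul, hz, chargedStep]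
      simp only [smul_eq_mul, zsmul_eq_mul]
      ring
    have h2 := zPow_mul_zPow r (-1)
    have h3 : chargedStep (a + r) (chargedSeries a k) =
        chargedStep a (chargedSeries a k) + r • (zPow (-1) * chargedSeries a k) := by
      rw [chargedStep, chargedStep]
      simp only [zsmul_eq_mul]
      push_cast
      ring
    have h4 : chargedStep (a + r) (chargedSeries (a + r) k - chargedSeries a k) +
        chargedStep (a + r) (chargedSeries a k) =
          chargedStep (a + r) (chargedSeries (a + r) k) := by
      rw [← chargedStep_add, sub_add_cancel]
    rw [chargedSeries_succ, chargedSeries_succ, h1, ih, chargedStep_zPow_mul,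
      eq_sub_of_add_eq h4, h3, sub_eq_add_neg r 1, ← h2]
    simp only [zsmul_eq_mul]
    ring

/-! ### Derivatives of `J(z)` and of the vertex operator -/

theorem coeff_linearForm (a : ℕ+ → LaurentSeries TPoly) (β : ℕ+ →₀ ℕ) :
    MvPowerSeries.coeff β (linearForm a) =
      ∑ n ∈ β.support, if β = Finsupp.single n 1 then a n else 0 := rfl

theorem constantCoeff_linearForm (a : ℕ+ → LaurentSeries TPoly) :
    MvPowerSeries.constantCoeff (linearForm a) = 0 := by
  rw [← MvPowerSeries.coeff_zero_eq_constantCoeff_apply, coeff_linearForm]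
  simp

theorem pDeriv_ofPowerSeries (r : ℕ+) (g : PowerSeries TPoly) :
    pDeriv r (ofPowerSeries g) = 0 :=
  MvPowerSeries.pderiv_C

theorem pDeriv_linearForm (r : ℕ+) (a : ℕ+ → LaurentSeries TPoly) :
    pDeriv r (linearForm a) = MvPowerSeries.C (a r) := by
  ext1 β
  rw [coeff_pDeriv, coeff_linearForm, MvPowerSeries.coeff_C]
  split_ifs with h
  · subst h
    rw [Finset.sum_eq_single r]
    · simp
    · intro n _ hn
      rw [if_neg]
      intro h
      have := DFunLike.congr_fun h n
      simp [Ne.symm hn] at this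
    · intro h
      simp at h
  · rw [Finset.sum_eq_zero, zero_mul]
    intro n _
    rw [if_neg]
    intro hn
    apply h
    ext i
    have h1 := DFunLike.congr_fun hn r
    have h2 := DFunLike.congr_fun hn i
    simp only [Finsupp.add_apply, Finsupp.single_apply, Finsupp.zero_apply] at h1 h2 ⊢
    split_ifs at h1 h2 <;> simp_all

theorem tDeriv_linearForm (r : ℕ+) (a : ℕ+ → LaurentSeries TPoly)
    (ha : ∀ n, HahnSeries.mapDerivation (MvPolynomial.pderiv r) (a n) = 0) :
    tDeriv r (linearForm a) = 0 := by
  ext1 β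
  rw [coeff_tDeriv, coeff_linearForm, map_sum, map_zero]
  refine Finset.sum_eq_zero fun n _ => ?_
  split_ifs
  · exact ha n
  · exact map_zero _

theorem tDeriv_ofPowerSeries (r : ℕ+) (g : PowerSeries TPoly) :
    tDeriv r (ofPowerSeries g) =
      ofPowerSeries (MvPowerSeries.mapDerivation (MvPolynomial.pderiv r) g) := by
  ext1 β
  rw [coeff_tDeriv, ofPowerSeries, ofPowerSeries, MvPowerSeries.coeff_C, MvPowerSeries.coeff_C]
  split_ifs
  · refine HahnSeries.ext (funext fun n => ?_)
    rw [HahnSeries.coeff_mapDerivation]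
    change MvPolynomial.pderiv r (HahnSeries.coeff (g : LaurentSeries TPoly) n) =
      HahnSeries.coeff ((MvPowerSeries.mapDerivation (MvPolynomial.pderiv r) g :
        PowerSeries TPoly) : LaurentSeries TPoly) n
    rw [PowerSeries.coeff_coe, PowerSeries.coeff_coe]
    split_ifs
    · exact map_zero _
    · rfl
  · exact map_zero _

theorem ofPowerSeries_X_pow (n : ℕ) : ofPowerSeries (PowerSeries.X ^ n) = zPow n := by
  rw [ofPowerSeries, HahnSeries.ofPowerSeries_X_pow, zPow]

theorem mapDerivation_single_C (r : ℕ+) (n : ℤ) (c : ℂ) :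
    HahnSeries.mapDerivation (MvPolynomial.pderiv r)
      (HahnSeries.single n (MvPolynomial.C c : TPoly)) = 0 := by
  refine HahnSeries.ext (funext fun i => ?_)
  rw [HahnSeries.coeff_mapDerivation, HahnSeries.coeff_single]
  split_ifs
  · simp
  · simp

theorem tDeriv_J (r : ℕ+) : tDeriv r (J 0) = (r : ℤ) • zPow ((r : ℤ) - 1) := by
  have hr : ((r : ℕ) - 1 : ℕ) = ((r : ℤ) - 1) := by have := r.pos; omega
  rw [J, map_add, tDeriv_linearForm, add_zero, tDeriv_ofPowerSeries, ← hr, ← ofPowerSeries_X_pow]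
  · rw [ofPowerSeries, ofPowerSeries, ← map_zsmul, ← map_zsmul]
    congr 2
    refine PowerSeries.ext fun n => ?_
    change MvPolynomial.pderiv r (PowerSeries.coeff n (PowerSeries.mk _)) = _
    rw [PowerSeries.coeff_mk, map_zsmul, PowerSeries.coeff_X_pow, zero_pow (Nat.succ_ne_zero n),
      sub_zero, one_mul, MvPolynomial.pderiv_C_mul]
    by_cases h : n = (r : ℕ) - 1
    · have h' : n.succPNat = r := by
        apply PNat.eq
        rw [Nat.succPNat_coe]
        have := r.pos
        omega
      have h2 : n + 1 = (r : ℕ) := by have := r.pos; omega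
      rw [if_pos h, h', MvPolynomial.pderiv_X_self, h2, mul_one, zsmul_eq_mul, mul_one]
      simp
    · have h' : n.succPNat ≠ r := by
        intro h'
        apply h
        rw [← h', Nat.succPNat_coe]
        rfl
      rw [if_neg h, MvPolynomial.pderiv_X_of_ne h', mul_zero, smul_zero]
  · intro n
    simpa using mapDerivation_single_C r (-(n : ℤ) - 1) 1

theorem pDeriv_J (r : ℕ+) : pDeriv r (J 0) = zPow (-(r : ℤ) - 1) := by
  rw [J, map_add, pDeriv_ofPowerSeries, zero_add, pDeriv_linearForm, zPow]

theorem tDeriv_BSeries (r : ℕ+) : tDeriv r (BSeries 0) = zPow (r : ℤ) * BSeries 0 := by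
  have h1 : tDeriv r ((PowerSeries.exp (LaurentSeries TPoly)).subst
      (linearForm fun n => HahnSeries.single (-(n : ℤ)) (MvPolynomial.C (-(1 / (n : ℂ)))))) = 0 := by
    rw [PowerSeries.derivation_exp_subst (tDeriv r)
        (fun e => ⟨e, (HahnSeries.mapDerivation (MvPolynomial.pderiv r) :
          Derivation ℂ (LaurentSeries TPoly) (LaurentSeries TPoly)).toLinearMap.toAddMonoidHom,
          fun F => rfl⟩)
        (constantCoeff_linearForm _),
      tDeriv_linearForm r _ fun n => mapDerivation_single_C r _ _, zero_mul]
  have h2 : MvPowerSeries.mapDerivation (MvPolynomial.pderiv r)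
      (PowerSeries.X * PowerSeries.mk fun j : ℕ =>
        (MvPolynomial.C (1 - (0 : ℂ) ^ (j + 1)) * MvPolynomial.X j.succPNat : TPoly)) =
      (PowerSeries.X ^ (r : ℕ) : PowerSeries TPoly) := by
    refine PowerSeries.ext fun n => ?_
    change MvPolynomial.pderiv r (PowerSeries.coeff n (PowerSeries.X * PowerSeries.mk _)) = _
    rw [PowerSeries.coeff_X_pow]
    cases n with
    | zero => simp [r.ne_zero.symm]
    | succ n =>
      rw [PowerSeries.coeff_succ_X_mul, PowerSeries.coeff_mk, zero_pow (Nat.succ_ne_zero n),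
        sub_zero, map_one, one_mul, MvPolynomial.pderiv_X, Pi.single_apply]
      refine if_congr ?_ rfl rfl
      rw [← PNat.coe_inj, Nat.succPNat_coe, eq_comm]
  rw [BSeries, Derivation.leibniz, h1, smul_zero, zero_add, tDeriv_ofPowerSeries,
    PowerSeries.derivation_exp_subst _ (fun e => ⟨e,
      (MvPolynomial.pderiv r : Derivation ℂ TPoly TPoly).toLinearMap.toAddMonoidHom, fun F => rfl⟩),
    h2, ← ofPowerSeries_X_pow]
  · rw [ofPowerSeries, ofPowerSeries, ofPowerSeries, map_mul, map_mul, smul_eq_mul]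
    ring
  · exact (map_mul PowerSeries.constantCoeff _ _).trans (by simp)

/-- The factor `-r` cancels the `-1/r` in the exponent; with `tDeriv_BSeries` this gives a single
rule, multiplication by `z^r`, for Heisenberg indices of either sign. -/
theorem pDeriv_BSeries (r : ℕ+) :
    -(r : ℤ) • pDeriv r (BSeries 0) = zPow (-(r : ℤ)) * BSeries 0 := by
  rw [BSeries, Derivation.leibniz, pDeriv_ofPowerSeries, smul_zero, add_zero,
    PowerSeries.derivation_exp_subst (pDeriv r) (fun e => ⟨e + Finsupp.single r 1,
      AddMonoidHom.mulRight ((e r : LaurentSeries TPoly) + 1), fun F => coeff_pDeriv r F e⟩)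
      (constantCoeff_linearForm _), pDeriv_linearForm, smul_eq_mul, mul_left_comm,
    ← smul_mul_assoc, zPow]
  congr 1
  rw [← map_zsmul]
  congr 1
  have h := map_zsmul (HahnSeries.single.addMonoidHom (R := TPoly) (-(r : ℤ))) (-(r : ℤ))
    (MvPolynomial.C (-(1 / (r : ℂ))))
  refine h.symm.trans ?_
  rw [← map_zsmul, zsmul_eq_mul]
  have : (r : ℂ) ≠ 0 := by exact_mod_cast r.ne_zero
  rw [show ((-(r : ℤ) : ℤ) : ℂ) * (-(1 / (r : ℂ))) = 1 by push_cast; field_simp, map_one]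
  rfl

theorem coeff_ofPowerSeries_mem {p : TPoly → Prop} (h0 : p 0) {g : PowerSeries TPoly}
    (hg : ∀ n, p (PowerSeries.coeff n g)) (N : ℤ) :
    p ((HahnSeries.ofPowerSeries ℤ TPoly g).coeff N) := by
  change p (HahnSeries.coeff (g : LaurentSeries TPoly) N)
  rw [PowerSeries.coeff_coe]
  split_ifs
  · exact h0
  · exact hg _

/-! ### Heisenberg operators and their commutation relations -/

/-- The Heisenberg operators: `∂/∂t_r` for `r > 0` and multiplication by `-r t_{-r}` for `r < 0`. -/
def heisenberg : ℤ → Module.End ℂ TPoly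
  | Int.ofNat 0 => 0
  | Int.ofNat (n + 1) => (MvPolynomial.pderiv n.succPNat).toLinearMap
  | Int.negSucc n => LinearMap.mulLeft ℂ (((n + 1 : ℕ) : TPoly) * MvPolynomial.X n.succPNat)

theorem heisenberg_coe (s : ℕ+) (f : TPoly) :
    heisenberg (s : ℤ) f = MvPolynomial.pderiv s f := by
  obtain ⟨n, rfl⟩ : ∃ n : ℕ, s = n.succPNat := ⟨s.natPred, (PNat.succPNat_natPred s).symm⟩
  rfl

theorem heisenberg_neg_coe (s : ℕ+) (f : TPoly) :
    heisenberg (-(s : ℤ)) f = (s : ℤ) • (MvPolynomial.X s * f) := by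
  obtain ⟨n, rfl⟩ : ∃ n : ℕ, s = n.succPNat := ⟨s.natPred, (PNat.succPNat_natPred s).symm⟩
  rw [zsmul_eq_mul, ← mul_assoc, Int.cast_natCast]
  rfl

theorem exists_eq_coe_or_neg_coe {r : ℤ} (hr : r ≠ 0) : ∃ s : ℕ+, r = s ∨ r = -(s : ℤ) := by
  refine ⟨⟨r.natAbs, Int.natAbs_pos.2 hr⟩, ?_⟩
  change r = (r.natAbs : ℤ) ∨ r = -(r.natAbs : ℤ)
  omega

/-- The constant term of a polynomial. -/
abbrev constTerm : TPoly →+* ℂ := MvPolynomial.constantCoeff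

theorem constTerm_heisenberg_of_neg {r : ℤ} (hr : r < 0) (f : TPoly) :
    constTerm (heisenberg r f) = 0 := by
  obtain ⟨s, rfl | rfl⟩ := exists_eq_coe_or_neg_coe hr.ne
  · omega
  · rw [heisenberg_neg_coe, map_zsmul, map_mul, MvPolynomial.constantCoeff_X, zero_mul, smul_zero]

theorem heisenberg_heisenberg {r s : ℤ} (hr : 0 < r) (hs : 0 < s) (f : TPoly) :
    heisenberg r (heisenberg (-s) f) =
      heisenberg (-s) (heisenberg r f) + if r = s then (r : ℂ) • f else 0 := by
  obtain ⟨r, rfl | rfl⟩ := exists_eq_coe_or_neg_coe hr.ne'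
  swap
  · omega
  obtain ⟨s, rfl | rfl⟩ := exists_eq_coe_or_neg_coe hs.ne'
  swap
  · omega
  rw [heisenberg_neg_coe, heisenberg_neg_coe, heisenberg_coe, heisenberg_coe, map_zsmul,
    Derivation.leibniz, smul_add, MvPolynomial.pderiv_X, Pi.single_apply, smul_eq_mul]
  congr 1
  have h : ((r : ℤ) = s) ↔ s = r := by
    rw [eq_comm, Nat.cast_inj, PNat.coe_inj]
  rw [if_congr h rfl rfl]
  split_ifs with h'
  · subst h'
    rw [smul_eq_mul, mul_one, ← Int.cast_smul_eq_zsmul ℂ]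
  · rw [smul_zero, smul_zero]

/-- `[α_r, F_N] = (δ F)_N` for an operator `δ` on generating series which satisfies
`δ = ∂/∂t_r` if `r > 0` and `δ = r ∂/∂p_{-r}` if `r < 0`. -/
theorem heisenberg_coeffOperator {F G : ZSymbol} {r : ℤ} (hr : r ≠ 0)
    (hpos : ∀ s : ℕ+, r = s → tDeriv s F = G)
    (hneg : ∀ s : ℕ+, r = -(s : ℤ) → r • pDeriv s F = G) (N : ℤ) (f : TPoly) :
    heisenberg r (coeffOperator N F f) =
      coeffOperator N F (heisenberg r f) + coeffOperator N G f := by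
  obtain ⟨s, h | h⟩ := exists_eq_coe_or_neg_coe hr
  · rw [← hpos s h, h, heisenberg_coe, heisenberg_coe, pderiv_coeffOperator]
  · rw [← hneg s h, h, heisenberg_neg_coe, heisenberg_neg_coe, map_zsmul, coeffOperator_X_mul,
      map_zsmul, LinearMap.smul_apply, smul_add, neg_smul]
    abel

theorem heisenberg_B {r : ℤ} (hr : r ≠ 0) (n : ℤ) (f : TPoly) :
    heisenberg r (B 0 n f) = B 0 n (heisenberg r f) + B 0 (n - r) f := by
  have h := heisenberg_coeffOperator (F := BSeries 0) (G := zPow r * BSeries 0) hr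
    (by rintro s rfl; exact tDeriv_BSeries s) (by rintro s rfl; exact pDeriv_BSeries s) n f
  rwa [coeffOperator_zPow_mul] at h

/-- The coefficient of `z^{-m-k}` in `:(∂_z + J(z) + a z⁻¹)^k 1:`, as an operator. -/
def chargedP (k : ℕ) (a m : ℤ) : Module.End ℂ TPoly :=
  coeffOperator (-m - k) (chargedSeries a k)

theorem P_eq_chargedP {k : ℕ} (hk : 1 ≤ k) (m : ℤ) : P 0 k m = chargedP k 0 m := by
  rw [P, PSeries_eq_chargedSeries hk]
  rfl

theorem heisenberg_chargedP {r : ℤ} (hr : r ≠ 0) (k : ℕ) (a m : ℤ) (f : TPoly) :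
    heisenberg r (chargedP k a m f) =
      chargedP k a m (heisenberg r f) +
        (chargedP k (a + r) (m + r) f - chargedP k a (m + r) f) := by
  have h := heisenberg_coeffOperator (F := chargedSeries a k)
    (G := zPow r * (chargedSeries (a + r) k - chargedSeries a k)) hr
    (by
      rintro s rfl
      exact derivation_chargedSeries _ _ (tDeriv_zDeriv s) (tDeriv_zPow s) (tDeriv_J s) a k)
    (by
      rintro s rfl
      refine derivation_chargedSeries (-(s : ℤ) • pDeriv s) _ (fun F => ?_) (fun j => ?_) ?_ a k
      · rw [Derivation.smul_apply, Derivation.smul_apply, pDeriv_zDeriv]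
        have : ∀ (n : ℤ) (F : ZSymbol), zDeriv (n • F) = n • zDeriv F := fun n F =>
          map_zsmul (AddMonoidHom.mk' zDeriv zDeriv_add) n F
        rw [this]
      · rw [Derivation.smul_apply, pDeriv_zPow]
        exact zsmul_zero _
      · rw [Derivation.smul_apply, pDeriv_J]) (-m - k) f
  rw [coeffOperator_zPow_mul, map_sub, show -m - (k : ℤ) - r = -(m + r) - k by ring] at h
  exact h

/-! ### Vacuum expectations of single operators -/

theorem constTerm_coeff_mul_eq_zero {x : LaurentSeries TPoly} (hx : ∀ n, constTerm (x.coeff n) = 0)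
    (y : LaurentSeries TPoly) (n : ℤ) : constTerm ((x * y).coeff n) = 0 := by
  rw [HahnSeries.coeff_mul, map_sum]
  refine Finset.sum_eq_zero fun p _ => ?_
  rw [map_mul, hx, zero_mul]

theorem coeff_zero_mul (F G : ZSymbol) : MvPowerSeries.coeff 0 (F * G) =
    MvPowerSeries.coeff 0 F * MvPowerSeries.coeff 0 G := by
  simp only [MvPowerSeries.coeff_zero_eq_constantCoeff_apply, map_mul]

theorem coeff_zero_J : MvPowerSeries.coeff 0 (J 0) =
    HahnSeries.ofPowerSeries ℤ TPoly (PowerSeries.mk fun j : ℕ =>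
      MvPolynomial.C ((1 - 0 ^ (j + 1)) * ((j + 1 : ℕ) : ℂ)) * MvPolynomial.X j.succPNat) := by
  rw [J, map_add, MvPowerSeries.coeff_zero_eq_constantCoeff_apply (linearForm _),
    constantCoeff_linearForm, add_zero, ofPowerSeries, MvPowerSeries.coeff_zero_C]

/-- At `t = 0` and `p = 0` the field `J` disappears, and `(∂_z + a z⁻¹)^k 1 = [a]_k z^{-k}`. -/
theorem constTerm_chargedSeries (k : ℕ) (a N : ℤ) :
    constTerm ((MvPowerSeries.coeff 0 (chargedSeries a k)).coeff N) =
      if N = -k then (fallingFactorial a k : ℂ) else 0 := by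
  induction k generalizing N with
  | zero =>
    rw [chargedSeries, Function.iterate_zero_apply, MvPowerSeries.coeff_zero_one,
      HahnSeries.coeff_one]
    split_ifs <;> simp_all [fallingFactorial]
  | succ k ih =>
    have hz (n : ℤ) (x : LaurentSeries TPoly) (N : ℤ) : (n • x).coeff N = n • x.coeff N :=
      map_zsmul (HahnSeries.coeff.addMonoidHom N) n x
    have hs (x : LaurentSeries TPoly) :
        (HahnSeries.single (-1) (1 : TPoly) * x).coeff N = x.coeff (N + 1) := by
      have := HahnSeries.coeff_single_mul_add (r := (1 : TPoly)) (x := x) (a := N + 1) (b := -1)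
      rwa [add_neg_cancel_right, one_mul] at this
    rw [chargedSeries_succ, chargedStep, add_mul, map_add, map_add, coeff_zDeriv, smul_mul_assoc,
      map_zsmul, coeff_zPow_mul, HahnSeries.coeff_add, HahnSeries.coeff_add, coeff_derivative,
      hz, hs, map_add, map_add, map_zsmul, map_zsmul,
      coeff_zero_mul, coeff_zero_J, constTerm_coeff_mul_eq_zero, zero_add, ih,
      ← add_smul]
    · by_cases h : N + 1 = -k
      · rw [if_pos h, if_pos (by push_cast; omega), h, zsmul_eq_mul, fallingFactorial,
          fallingFactorial, Finset.prod_range_succ]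
        push_cast
        ring
      · rw [if_neg h, if_neg (by push_cast; omega), smul_zero]
    · refine coeff_ofPowerSeries_mem (p := fun f => constTerm f = 0) (map_zero _) fun n => ?_
      rw [PowerSeries.coeff_mk, map_mul, MvPolynomial.constantCoeff_X, mul_zero]

theorem constTerm_chargedP_one (k : ℕ) (a m : ℤ) :
    constTerm (chargedP k a m 1) = if m = 0 then (fallingFactorial a k : ℂ) else 0 := by
  rw [chargedP, coeffOperator_one, constTerm_chargedSeries]
  refine if_congr ?_ rfl rfl
  omega

/-- Acting on `1` only the `p⁰` part survives, and `exp(∑ t_n z^n)` becomes `1` at `t = 0`. -/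
theorem constTerm_B_one (n : ℤ) : constTerm (B 0 n 1) = if n = 0 then 1 else 0 := by
  set a : PowerSeries TPoly := PowerSeries.X * PowerSeries.mk fun j : ℕ =>
    (MvPolynomial.C (1 - (0 : ℂ) ^ (j + 1)) * MvPolynomial.X j.succPNat : TPoly) with ha
  have ha0 : MvPowerSeries.constantCoeff a = 0 :=
    (map_mul PowerSeries.constantCoeff _ _).trans (by simp)
  have ha1 : PowerSeries.map constTerm a = 0 := by
    ext n
    rw [PowerSeries.coeff_map, ha]
    cases n with
    | zero => simp
    | succ n => simp [PowerSeries.coeff_succ_X_mul]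
  have h1 (n : ℕ) : constTerm (PowerSeries.coeff n ((PowerSeries.exp ℂ).subst a)) =
      if n = 0 then 1 else 0 := by
    have hN : (Finsupp.single () n).degree < n + 1 := by simp
    have h := PowerSeries.coeff_subst_eq_coeff_sum ha0 (PowerSeries.exp ℂ) hN
    change constTerm (MvPowerSeries.coeff (Finsupp.single () n) _) = _
    rw [h]
    change constTerm (PowerSeries.coeff n (∑ d ∈ Finset.range (n + 1),
      PowerSeries.coeff d (PowerSeries.exp ℂ) • a ^ d)) = _
    rw [map_sum, map_sum, Finset.sum_range_succ', Finset.sum_eq_zero, zero_add]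
    · simp only [PowerSeries.coeff_zero_eq_constantCoeff, PowerSeries.constantCoeff_exp, one_smul,
        pow_zero, PowerSeries.coeff_one]
      split_ifs <;> simp
    · intro d _
      have h2 : constTerm (PowerSeries.coeff n (a ^ (d + 1))) = 0 := by
        rw [← PowerSeries.coeff_map, map_pow, ha1, zero_pow (Nat.succ_ne_zero d), map_zero]
      change constTerm (PowerSeries.coeff (d + 1) (PowerSeries.exp ℂ) •
        PowerSeries.coeff n (a ^ (d + 1))) = 0
      rw [MvPolynomial.smul_eq_C_mul, map_mul, h2, mul_zero]
  have h2 : B 0 n 1 = (HahnSeries.ofPowerSeries ℤ TPoly ((PowerSeries.exp ℂ).subst a)).coeff n := by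
    change coeffOperator n (BSeries 0) 1 = _
    rw [coeffOperator_one, BSeries, coeff_zero_mul, ofPowerSeries,
      MvPowerSeries.coeff_zero_C]
    have : MvPowerSeries.coeff 0 ((PowerSeries.exp (LaurentSeries TPoly)).subst
      (linearForm fun n => HahnSeries.single (-(n : ℤ)) (MvPolynomial.C (-(1 / (n : ℂ)))))) = 1 := by
      rw [PowerSeries.coeff_subst_eq_coeff_sum (N := 1) (constantCoeff_linearForm _) _ (by simp)]
      simp
    rw [this, mul_one]
  rw [h2]
  change constTerm (HahnSeries.coeff (((PowerSeries.exp ℂ).subst a : PowerSeries TPoly) :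
    LaurentSeries TPoly) n) = _
  rw [PowerSeries.coeff_coe]
  split_ifs with h3 h4 h4
  · omega
  · exact map_zero _
  · rw [h1, if_pos (by simp [h4])]
  · rw [h1, if_neg (by simpa using h4)]

/-! ### Uniqueness principles, Euler's identity and a telescoping recursion -/

theorem heisenberg_one {r : ℤ} (hr : 0 < r) : heisenberg r 1 = 0 := by
  obtain ⟨s, rfl | rfl⟩ := exists_eq_coe_or_neg_coe hr.ne'
  · rw [heisenberg_coe, MvPolynomial.pderiv_one]
  · omega

theorem heisenberg_comm_of_pos {r s : ℤ} (hr : 0 < r) (hs : 0 < s) (f : TPoly) :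
    heisenberg r (heisenberg s f) = heisenberg s (heisenberg r f) := by
  obtain ⟨r, rfl | rfl⟩ := exists_eq_coe_or_neg_coe hr.ne'
  swap
  · omega
  obtain ⟨s, rfl | rfl⟩ := exists_eq_coe_or_neg_coe hs.ne'
  swap
  · omega
  simp only [heisenberg_coe]
  exact LeftCommutative.left_comm (op := fun (n : ℕ+) (g : TPoly) => MvPolynomial.pderiv n g) r s f

/-- A property which is stable under partial derivatives and implies that the constant term
vanishes holds for the zero polynomial only. -/
theorem eq_zero_of_heisenberg (p : TPoly → Prop) (hc : ∀ f, p f → constTerm f = 0)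
    (hd : ∀ f, p f → ∀ r : ℤ, 0 < r → p (heisenberg r f)) {f : TPoly} (hf : p f) : f = 0 := by
  -- Taylor expansion: up to a nonzero factor, the coefficient of `t^{γ+ε_r}` in `f` is that of
  -- `t^γ` in `∂f/∂t_r`.
  have key (n : ℕ) : ∀ β : ℕ+ →₀ ℕ, β.degree = n → ∀ f, p f → MvPolynomial.coeff β f = 0 := by
    induction n with
    | zero =>
      intro β hβ f hf
      rw [(Finsupp.degree_eq_zero_iff β).1 hβ]
      exact hc f hf
    | succ n ih =>
      intro β hβ f hf
      have h0 : β ≠ 0 := by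
        rintro rfl
        simp at hβ
      obtain ⟨r, hr⟩ := Finsupp.ne_iff.1 h0
      obtain ⟨γ, rfl⟩ : ∃ γ, β = γ + Finsupp.single r 1 :=
        ⟨β - Finsupp.single r 1,
          (tsub_add_cancel_of_le (by simpa [Nat.one_le_iff_ne_zero] using hr)).symm⟩
      have h1 := ih γ (by rw [map_add, Finsupp.degree_single] at hβ; omega) _
        (hd f hf r (by exact_mod_cast r.pos))
      rw [heisenberg_coe, MvPolynomial.coeff_pderiv] at h1
      exact (mul_eq_zero.1 h1).resolve_right (Nat.cast_add_one_ne_zero _)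
  ext β
  rw [key _ β rfl f hf, MvPolynomial.coeff_zero]

theorem eq_C_of_heisenberg_eq_zero {f : TPoly} (hf : ∀ r : ℤ, 0 < r → heisenberg r f = 0) :
    f = MvPolynomial.C (constTerm f) := by
  refine sub_eq_zero.1 (eq_zero_of_heisenberg
    (fun g => constTerm g = 0 ∧ ∀ r : ℤ, 0 < r → heisenberg r g = 0) (fun _ h => h.1) ?_ ⟨?_, ?_⟩)
  · rintro g ⟨_, hg⟩ r hr
    rw [hg r hr]
    exact ⟨map_zero _, fun s _ => map_zero _⟩
  · rw [map_sub, MvPolynomial.constantCoeff_C, sub_self]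
  · intro r hr
    rw [map_sub, hf r hr, ← mul_one (MvPolynomial.C _), ← MvPolynomial.smul_eq_C_mul, map_smul,
      heisenberg_one hr, smul_zero, sub_zero]

/-- A linear space of operators stable under commutation with the Heisenberg operators, all of
whose elements have vacuum expectation zero, is zero. -/
theorem operator_eq_zero (V : Submodule ℂ (Module.End ℂ TPoly))
    (hc : ∀ X ∈ V, constTerm (X 1) = 0)
    (hd : ∀ X ∈ V, ∀ r : ℤ, r ≠ 0 → ∃ Y ∈ V, ∀ f,
      heisenberg r (X f) = X (heisenberg r f) + Y f)
    {X : Module.End ℂ TPoly} (hX : X ∈ V) : X = 0 := by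
  have h1 : ∀ X ∈ V, X 1 = 0 := by
    intro X hX
    refine eq_zero_of_heisenberg (fun f => ∃ X ∈ V, f = X 1) ?_ ?_ ⟨X, hX, rfl⟩
    · rintro _ ⟨X, hX, rfl⟩
      exact hc X hX
    · rintro _ ⟨X, hX, rfl⟩ r hr
      obtain ⟨Y, hY, h⟩ := hd X hX r hr.ne'
      refine ⟨Y, hY, ?_⟩
      rw [h, heisenberg_one hr, map_zero, zero_add]
  -- Multiplications by the `t_s` generate all polynomials from the vacuum, and the commutator of
  -- `X` with such a multiplication again lies in `V`.
  have h2 (f : TPoly) : ∀ X ∈ V, X f = 0 := by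
    induction f using MvPolynomial.induction_on with
    | C c =>
      intro X hX
      rw [← mul_one (MvPolynomial.C c), ← MvPolynomial.smul_eq_C_mul, map_smul, h1 X hX, smul_zero]
    | add f g hf hg =>
      intro X hX
      rw [map_add, hf X hX, hg X hX, add_zero]
    | mul_X f s ih =>
      intro X hX
      have hs : (s : ℤ) ≠ 0 := by exact_mod_cast s.ne_zero
      obtain ⟨Y, hY, h⟩ := hd X hX (-(s : ℤ)) (neg_ne_zero.2 hs)
      have h3 := h f
      rw [ih X hX, ih Y hY, map_zero, add_zero, heisenberg_neg_coe, map_zsmul,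
        ← Int.cast_smul_eq_zsmul ℂ] at h3
      rw [mul_comm]
      exact (smul_eq_zero.1 h3.symm).resolve_left (by exact_mod_cast hs)
  exact LinearMap.ext fun f => h2 f X hX

theorem eq_zero_of_weight_neg {V : ℤ → Submodule ℂ TPoly}
    (hd : ∀ w, ∀ f ∈ V w, ∀ r : ℤ, 0 < r → heisenberg r f ∈ V (w - r))
    (hc : ∀ w, w ≠ 0 → ∀ f ∈ V w, constTerm f = 0) {w : ℤ} (hw : w < 0) {f : TPoly}
    (hf : f ∈ V w) : f = 0 := by
  refine eq_zero_of_heisenberg (fun f => ∃ w < 0, f ∈ V w) ?_ ?_ ⟨w, hw, hf⟩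
  · rintro f ⟨w, hw, hf⟩
    exact hc w hw.ne f hf
  · rintro f ⟨w, hw, hf⟩ r hr
    exact ⟨w - r, by omega, hd w f hf r hr⟩

/-- Euler's identity for polynomials of weight `N`. -/
theorem sum_heisenberg_heisenberg {V : ℤ → Submodule ℂ TPoly}
    (hd : ∀ w, ∀ f ∈ V w, ∀ r : ℤ, 0 < r → heisenberg r f ∈ V (w - r))
    (hc : ∀ w, w ≠ 0 → ∀ f ∈ V w, constTerm f = 0) {N : ℕ} {f : TPoly} (hf : f ∈ V N) :
    (N : ℂ) • f = ∑ i ∈ Finset.range N, heisenberg (-(i + 1 : ℤ)) (heisenberg (i + 1 : ℤ) f) := by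
  suffices h : ((N : ℤ) : ℂ) • f -
      ∑ i ∈ Finset.range N, heisenberg (-(i + 1 : ℤ)) (heisenberg (i + 1 : ℤ) f) = 0 by
    exact_mod_cast sub_eq_zero.1 h
  -- The length `N` of the sum stays fixed while the weight `w` is allowed to drop; this makes the
  -- family stable under derivatives. Moving `∂/∂t_r` past the `r`-th summand creates the term `r
  -- ∂f/∂t_r` that lowers `w` to `w - r`.
  refine eq_zero_of_heisenberg (fun g => ∃ w ≤ (N : ℤ), ∃ f ∈ V w, g = (w : ℂ) • f -
    ∑ i ∈ Finset.range N, heisenberg (-(i + 1 : ℤ)) (heisenberg (i + 1 : ℤ) f))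
    ?_ ?_ ⟨N, le_rfl, f, hf, rfl⟩
  · rintro _ ⟨w, _, f, hf, rfl⟩
    rw [map_sub, map_sum, Finset.sum_eq_zero, sub_zero, MvPolynomial.smul_eq_C_mul, map_mul,
      MvPolynomial.constantCoeff_C]
    · by_cases hw : w = 0
      · rw [hw, Int.cast_zero, zero_mul]
      · rw [hc w hw f hf, mul_zero]
    · intro i _
      exact constTerm_heisenberg_of_neg (by omega) _
  · rintro _ ⟨w, hw, f, hf, rfl⟩ r hr
    refine ⟨w - r, by omega, heisenberg r f, hd w f hf r hr, ?_⟩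
    have h1 (i : ℕ) : heisenberg r (heisenberg (-(i + 1 : ℤ)) (heisenberg (i + 1 : ℤ) f)) =
        heisenberg (-(i + 1 : ℤ)) (heisenberg (i + 1 : ℤ) (heisenberg r f)) +
          if r = i + 1 then (r : ℂ) • heisenberg r f else 0 := by
      rw [heisenberg_heisenberg hr (by omega), heisenberg_comm_of_pos hr (by omega)]
      congr 1
      refine ite_congr rfl (fun h => ?_) fun _ => rfl
      rw [h]
    have h2 : ∑ i ∈ Finset.range N, (if r = i + 1 then (r : ℂ) • heisenberg r f else 0) =
        (r : ℂ) • heisenberg r f := by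
      by_cases hN : r ≤ N
      · rw [Finset.sum_eq_single (r - 1).toNat]
        · rw [if_pos (by omega)]
        · intro i _ hi
          rw [if_neg (by omega)]
        · intro h
          simp only [Finset.mem_range] at h
          omega
      -- For `r > N ≥ w` no summand has index `r`, but then the derivative has negative weight and
      -- vanishes.
      · rw [eq_zero_of_weight_neg hd hc (by omega) (hd w f hf r hr)]
        simp
    rw [map_sub, map_sum, map_smul, Finset.sum_congr rfl fun i _ => h1 i, Finset.sum_add_distrib,
      h2, Int.cast_sub, sub_smul]
    abel

/-- A telescoping recursion. -/
theorem eq_sub_of_recursion {F : ℤ → ℂ} {W : ℕ → ℤ → ℂ} (h0 : ∀ a, W 0 a = F a)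
    (h : ∀ (N : ℕ) (a : ℤ), (N : ℂ) * W N a =
      ∑ i ∈ Finset.range N, (W (N - 1 - i) a - W (N - 1 - i) (a - (i + 1))))
    (N : ℕ) (hN : N ≠ 0) (a : ℤ) : W N a = F a - F (a - 1) := by
  induction N using Nat.strong_induction_on generalizing a with
  | _ N ih =>
    obtain ⟨K, rfl⟩ := Nat.exists_eq_succ_of_ne_zero hN
    have hK : ((K + 1 : ℕ) : ℂ) ≠ 0 := by exact_mod_cast Nat.succ_ne_zero K
    apply mul_left_cancel₀ hK
    rw [h, Finset.sum_range_succ, Nat.add_sub_cancel, Nat.sub_self, h0, h0]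
    have h1 : ∑ i ∈ Finset.range K, (W (K - i) a - W (K - i) (a - (i + 1))) =
        ∑ i ∈ Finset.range K, ((F a - F (a - 1)) -
          (F (a - 1 - (i : ℕ)) - F (a - 1 - ((i + 1 : ℕ) : ℤ)))) := by
      refine Finset.sum_congr rfl fun i hi => ?_
      have hi' := Finset.mem_range.1 hi
      rw [ih (K - i) (by omega) (by omega), ih (K - i) (by omega) (by omega)]
      push_cast
      ring_nf
    rw [h1, Finset.sum_sub_distrib, Finset.sum_range_sub' (fun i : ℕ => F (a - 1 - (i : ℤ))),
      Finset.sum_const, Finset.card_range, nsmul_eq_mul]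
    push_cast
    ring_nf

/-! ### Weights and Newton-type identities for `B_n · 1` and `P_{a,m} · 1` -/

theorem constTerm_smul (c : ℂ) (f : TPoly) : constTerm (c • f) = c * constTerm f := by
  rw [MvPolynomial.smul_eq_C_mul, map_mul, MvPolynomial.constantCoeff_C]

theorem heisenberg_B_one {r : ℤ} (hr : 0 < r) (n : ℤ) :
    heisenberg r (B 0 n 1) = B 0 (n - r) 1 := by
  rw [heisenberg_B hr.ne', heisenberg_one hr, map_zero, zero_add]

theorem heisenberg_chargedP_one {r : ℤ} (hr : 0 < r) (k : ℕ) (a m : ℤ) :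
    heisenberg r (chargedP k a m 1) =
      chargedP k (a + r) (m + r) 1 - chargedP k a (m + r) 1 := by
  rw [heisenberg_chargedP hr.ne', heisenberg_one hr, map_zero, zero_add]

/-- The spaces spanned by the complete symmetric functions. -/
def completeSpan (w : ℤ) : Submodule ℂ TPoly := Submodule.span ℂ {B 0 w 1}

theorem heisenberg_mem_completeSpan (w : ℤ) (f : TPoly) (hf : f ∈ completeSpan w) (r : ℤ)
    (hr : 0 < r) : heisenberg r f ∈ completeSpan (w - r) := by
  obtain ⟨c, rfl⟩ := Submodule.mem_span_singleton.1 hf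
  rw [map_smul, heisenberg_B_one hr]
  exact Submodule.smul_mem _ _ (Submodule.mem_span_singleton_self _)

theorem constTerm_of_mem_completeSpan (w : ℤ) (hw : w ≠ 0) (f : TPoly)
    (hf : f ∈ completeSpan w) : constTerm f = 0 := by
  obtain ⟨c, rfl⟩ := Submodule.mem_span_singleton.1 hf
  rw [constTerm_smul, constTerm_B_one, if_neg hw, mul_zero]

/-- The spaces spanned by the values at `1` of the operators `chargedP k a m`. -/
def chargedSpan (k : ℕ) (w : ℤ) : Submodule ℂ TPoly :=
  Submodule.span ℂ (Set.range fun a : ℤ => chargedP k a (-w) 1)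

theorem heisenberg_mem_chargedSpan (k : ℕ) (w : ℤ) (f : TPoly) (hf : f ∈ chargedSpan k w) (r : ℤ)
    (hr : 0 < r) : heisenberg r f ∈ chargedSpan k (w - r) := by
  have h : chargedSpan k w ≤ (chargedSpan k (w - r)).comap (heisenberg r) := by
    refine Submodule.span_le.2 ?_
    rintro _ ⟨a, rfl⟩
    change heisenberg r _ ∈ chargedSpan k (w - r)
    rw [heisenberg_chargedP_one hr, show -w + r = -(w - r) by ring]
    exact Submodule.sub_mem _ (Submodule.subset_span ⟨_, rfl⟩) (Submodule.subset_span ⟨_, rfl⟩)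
  exact h hf

theorem constTerm_of_mem_chargedSpan (k : ℕ) (w : ℤ) (hw : w ≠ 0) (f : TPoly)
    (hf : f ∈ chargedSpan k w) : constTerm f = 0 := by
  induction hf using Submodule.span_induction with
  | mem f hf =>
    obtain ⟨a, rfl⟩ := hf
    exact (constTerm_chargedP_one k a (-w)).trans (if_neg (neg_ne_zero.2 hw))
  | zero => exact map_zero _
  | add f g _ _ hf hg => rw [map_add, hf, hg, add_zero]
  | smul c f _ hf => rw [constTerm_smul, hf, mul_zero]

theorem B_one_of_neg {n : ℤ} (hn : n < 0) : B 0 n 1 = 0 :=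
  eq_zero_of_weight_neg heisenberg_mem_completeSpan constTerm_of_mem_completeSpan hn
    (Submodule.mem_span_singleton_self _)

theorem B_zero_one : B 0 0 1 = 1 := by
  rw [eq_C_of_heisenberg_eq_zero (f := B 0 0 1), constTerm_B_one, if_pos rfl, map_one]
  intro r hr
  rw [heisenberg_B_one hr, B_one_of_neg (by omega)]

theorem chargedP_one_of_pos (k : ℕ) (a : ℤ) {m : ℤ} (hm : 0 < m) : chargedP k a m 1 = 0 := by
  refine eq_zero_of_weight_neg (heisenberg_mem_chargedSpan k) (constTerm_of_mem_chargedSpan k)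
    (w := -m) (by omega) (Submodule.subset_span ⟨a, ?_⟩)
  rw [neg_neg]

theorem chargedP_zero_one (k : ℕ) (a : ℤ) :
    chargedP k a 0 1 = MvPolynomial.C (fallingFactorial a k : ℂ) := by
  rw [eq_C_of_heisenberg_eq_zero (f := chargedP k a 0 1), constTerm_chargedP_one, if_pos rfl]
  intro r hr
  rw [heisenberg_chargedP_one hr, chargedP_one_of_pos _ _ (by omega),
    chargedP_one_of_pos _ _ (by omega), sub_zero]

theorem natCast_smul_B_one (N : ℕ) : (N : ℂ) • B 0 N 1 =
    ∑ i ∈ Finset.range N, heisenberg (-(i + 1 : ℤ)) (B 0 (N - (i + 1)) 1) := by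
  rw [sum_heisenberg_heisenberg heisenberg_mem_completeSpan constTerm_of_mem_completeSpan
    (Submodule.mem_span_singleton_self _)]
  exact Finset.sum_congr rfl fun i _ => by rw [heisenberg_B_one (by omega)]

theorem natCast_smul_chargedP_one (k N : ℕ) (a : ℤ) : (N : ℂ) • chargedP k a (-N) 1 =
    ∑ i ∈ Finset.range N, heisenberg (-(i + 1 : ℤ))
      (chargedP k (a + (i + 1)) (-N + (i + 1)) 1 - chargedP k a (-N + (i + 1)) 1) := by
  rw [sum_heisenberg_heisenberg (heisenberg_mem_chargedSpan k) (constTerm_of_mem_chargedSpan k)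
    (Submodule.subset_span ⟨a, rfl⟩)]
  exact Finset.sum_congr rfl fun i _ => by rw [heisenberg_chargedP_one (by omega)]

/-! ### Vacuum expectations of products of two operators -/

theorem constTerm_chargedP_heisenberg {r : ℤ} (hr : r < 0) (k : ℕ) (a m : ℤ) (f : TPoly) :
    constTerm (chargedP k a m (heisenberg r f)) =
      constTerm (chargedP k a (m + r) f) - constTerm (chargedP k (a + r) (m + r) f) := by
  have h := congrArg constTerm (heisenberg_chargedP hr.ne k a m f)
  rw [constTerm_heisenberg_of_neg hr, map_add, map_sub] at h
  linear_combination -h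

theorem constTerm_B_heisenberg {r : ℤ} (hr : r < 0) (n : ℤ) (f : TPoly) :
    constTerm (B 0 n (heisenberg r f)) = -constTerm (B 0 (n - r) f) := by
  have h := congrArg constTerm (heisenberg_B hr.ne n f)
  rw [constTerm_heisenberg_of_neg hr, map_add] at h
  linear_combination -h

/-- Newton's identity writes `N h_N` as a sum of multiples of `t_r h_{N-r}`; moved to the far left,
`t_r` has no constant term, and its commutators with `P` give the telescoping recursion. The weight
mismatch `d` is unchanged throughout. -/
theorem constTerm_chargedP_B_one (k N : ℕ) (hN : N ≠ 0) (a d : ℤ) :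
    constTerm (chargedP k a (N + d) (B 0 N 1)) =
      if d = 0 then (fallingFactorial a k : ℂ) - fallingFactorial (a - 1) k else 0 := by
  have h := eq_sub_of_recursion (F := fun a => if d = 0 then (fallingFactorial a k : ℂ) else 0)
    (W := fun N a => constTerm (chargedP k a (N + d) (B 0 N 1))) ?_ ?_ N hN a
  · refine h.trans ?_
    split_ifs <;> simp
  · intro a
    rw [Nat.cast_zero, B_zero_one, constTerm_chargedP_one, zero_add]
  · intro N a
    have h1 := congrArg (fun f => constTerm (chargedP k a (N + d) f)) (natCast_smul_B_one N)
    simp only [map_smul, constTerm_smul, map_sum] at h1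
    refine h1.trans (Finset.sum_congr rfl fun i hi => ?_)
    have hi := Finset.mem_range.1 hi
    rw [constTerm_chargedP_heisenberg (by omega),
      show ((N - 1 - i : ℕ) : ℤ) = N - (i + 1) by omega,
      show (N : ℤ) + d + -(i + 1) = N - (i + 1) + d by ring, sub_eq_add_neg a]

theorem constTerm_B_chargedP_one (k N : ℕ) (hN : N ≠ 0) (a d : ℤ) :
    constTerm (B 0 (d - N) (chargedP k a (-N) 1)) =
      if d = 0 then (fallingFactorial a k : ℂ) - fallingFactorial (a + 1) k else 0 := by
  -- Here the creation operators raise the charge instead of lowering it, so the recursion is run in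
  -- `-a`.
  have h := eq_sub_of_recursion (F := fun a => if d = 0 then (fallingFactorial (-a) k : ℂ) else 0)
    (W := fun N a => constTerm (B 0 (d - N) (chargedP k (-a) (-N) 1))) ?_ ?_ N hN (-a)
  · rw [neg_neg] at h
    refine h.trans ?_
    rw [neg_sub, sub_neg_eq_add, add_comm 1 a]
    split_ifs <;> simp
  · intro a
    rw [Nat.cast_zero, neg_zero, sub_zero, chargedP_zero_one, ← mul_one (MvPolynomial.C _),
      ← MvPolynomial.smul_eq_C_mul, map_smul, constTerm_smul, constTerm_B_one, mul_ite, mul_one,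
      mul_zero]
  · intro N a
    have h1 := congrArg (fun f => constTerm (B 0 (d - N) f)) (natCast_smul_chargedP_one k N (-a))
    simp only [map_smul, constTerm_smul, map_sum] at h1
    refine h1.trans (Finset.sum_congr rfl fun i hi => ?_)
    have hi := Finset.mem_range.1 hi
    rw [constTerm_B_heisenberg (by omega), map_sub, map_sub,
      show ((N - 1 - i : ℕ) : ℤ) = N - (i + 1) by omega,
      show d - (N : ℤ) - -(i + 1) = d - (N - (i + 1)) by ring,
      show -(N : ℤ) + (i + 1) = -(N - (i + 1)) by ring,
      show -(a - (i + 1 : ℤ)) = -a + (i + 1) by ring]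
    ring

/-! ### The commutation relation between charged operators and vertex operators -/

/-- The backward difference of the falling factorial. -/
theorem fallingFactorial_sub {k : ℕ} (hk : 1 ≤ k) (x : ℤ) :
    fallingFactorial x k - fallingFactorial (x - 1) k =
      k * fallingFactorial (x - 1) (k - 1) := by
  obtain ⟨k, rfl⟩ := Nat.exists_eq_add_of_le' hk
  rw [Nat.add_sub_cancel, fallingFactorial, fallingFactorial, fallingFactorial,
    Finset.prod_range_succ', Finset.prod_range_succ (fun j : ℕ => x - 1 - (j : ℤ))]
  have : ∏ j ∈ Finset.range k, (x - ((j + 1 : ℕ) : ℤ)) =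
      ∏ j ∈ Finset.range k, (x - 1 - (j : ℤ)) :=
    Finset.prod_congr rfl fun j _ => by push_cast; ring
  rw [this]
  push_cast
  ring

/-- The coefficient in the commutation relation between `chargedP` and the vertex operators. -/
def shiftCoeff (k : ℕ) (x : ℤ) : ℂ := k * fallingFactorial x (k - 1)

theorem shiftCoeff_eq {k : ℕ} (hk : 1 ≤ k) (x : ℤ) :
    shiftCoeff k x = (fallingFactorial (x + 1) k : ℂ) - fallingFactorial x k := by
  have h := fallingFactorial_sub hk (x + 1)
  rw [add_sub_cancel_right] at h
  rw [shiftCoeff]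
  exact_mod_cast h.symm

/-- The deviation from the commutation relation `chargedP_B`. -/
def commutatorDefect (k : ℕ) (a m n : ℤ) : Module.End ℂ TPoly :=
  chargedP k a m * B 0 n - B 0 n * chargedP k (a - 1) m -
    shiftCoeff k (n - m + a - 1) • B 0 (n - m)

theorem commutatorDefect_apply (k : ℕ) (a m n : ℤ) (f : TPoly) :
    commutatorDefect k a m n f = chargedP k a m (B 0 n f) - B 0 n (chargedP k (a - 1) m f) -
      shiftCoeff k (n - m + a - 1) • B 0 (n - m) f := rfl

/-- The argument `n - m + a - 1` is unchanged by `(a, m) ↦ (a + r, m + r)`, and it takes equal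
values at `(m + r, n)` and `(m, n - r)`. The correction terms therefore match after two of them
cancel. -/
theorem heisenberg_commutatorDefect {r : ℤ} (hr : r ≠ 0) (k : ℕ) (a m n : ℤ) (f : TPoly) :
    heisenberg r (commutatorDefect k a m n f) =
      commutatorDefect k a m n (heisenberg r f) +
        (commutatorDefect k (a + r) (m + r) n - commutatorDefect k a (m + r) n +
          commutatorDefect k a m (n - r)) f := by
  simp only [LinearMap.add_apply, LinearMap.sub_apply, commutatorDefect_apply, map_sub, map_smul,
    heisenberg_chargedP hr, heisenberg_B hr, map_add]
  rw [show n - (m + r) + (a + r) - 1 = n - m + a - 1 by ring,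
    show n - (m + r) + a - 1 = n - r - m + a - 1 by ring,
    show n - (m + r) = n - m - r by ring, show n - r - m = n - m - r by ring,
    show a - 1 + r = a + r - 1 by ring, smul_add]
  abel

/-- Everything vanishes unless `n = m`. In that case the difference `[a]_k - [a-1]_k` comes from `P
B` alone when `n > 0`, from `B P` alone when `n < 0`, and from one term of each when `n = 0`. -/
theorem constTerm_commutatorDefect_one {k : ℕ} (hk : 1 ≤ k) (a m n : ℤ) :
    constTerm (commutatorDefect k a m n 1) = 0 := by
  have hU : constTerm (chargedP k a m (B 0 n 1)) = if n = m then (if n = 0 then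
      (fallingFactorial a k : ℂ) else if 0 < n then
        (fallingFactorial a k : ℂ) - fallingFactorial (a - 1) k else 0) else 0 := by
    rcases lt_trichotomy n 0 with hn | rfl | hn
    · rw [B_one_of_neg hn, map_zero, map_zero, if_neg hn.ne, if_neg hn.not_gt, ite_self]
    · rw [B_zero_one, constTerm_chargedP_one, if_pos rfl]
      exact if_congr eq_comm rfl rfl
    · lift n to ℕ using hn.le
      have h := constTerm_chargedP_B_one k n (by omega) a (m - n)
      rw [add_sub_cancel] at h
      rw [h, if_neg hn.ne', if_pos hn]
      exact if_congr (by omega) rfl rfl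
  have hV : constTerm (B 0 n (chargedP k (a - 1) m 1)) = if n = m then (if n = 0 then
      (fallingFactorial (a - 1) k : ℂ) else if n < 0 then
        (fallingFactorial (a - 1) k : ℂ) - fallingFactorial a k else 0) else 0 := by
    rcases lt_trichotomy m 0 with hm | rfl | hm
    · obtain ⟨N, rfl⟩ := Int.exists_eq_neg_ofNat hm.le
      have h := constTerm_B_chargedP_one k N (by omega) (a - 1) (n + N)
      rw [add_sub_cancel_right, sub_add_cancel] at h
      rw [h]
      by_cases hn : n = -(N : ℤ)
      · rw [if_pos (by omega), if_pos hn, if_neg (by omega), if_pos (by omega)]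
      · rw [if_neg (by omega), if_neg hn]
    · rw [chargedP_zero_one, ← mul_one (MvPolynomial.C _), ← MvPolynomial.smul_eq_C_mul, map_smul,
        constTerm_smul, constTerm_B_one]
      split_ifs <;> simp
    · rw [chargedP_one_of_pos _ _ hm, map_zero, map_zero]
      by_cases hn : n = m
      · rw [if_pos hn, if_neg (by omega), if_neg (by omega)]
      · rw [if_neg hn]
  rw [commutatorDefect_apply, map_sub, map_sub, hU, hV, constTerm_smul, constTerm_B_one,
    shiftCoeff_eq hk]
  by_cases h : n = m
  · subst h
    rw [if_pos rfl, if_pos rfl, sub_self, if_pos rfl, zero_add, sub_add_cancel]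
    rcases lt_trichotomy n 0 with hn | rfl | hn
    · rw [if_neg hn.ne, if_neg hn.not_gt, if_neg hn.ne, if_pos hn]
      ring
    · simp
    · rw [if_neg hn.ne', if_pos hn, if_neg hn.ne', if_neg hn.not_gt]
      ring
  · rw [if_neg h, if_neg h, if_neg (sub_ne_zero.2 h)]
    ring

theorem commutatorDefect_eq_zero {k : ℕ} (hk : 1 ≤ k) (a m n : ℤ) :
    commutatorDefect k a m n = 0 := by
  set X : ℤ × ℤ × ℤ → Module.End ℂ TPoly := fun i => commutatorDefect k i.1 i.2.1 i.2.2
  refine operator_eq_zero (Submodule.span ℂ (Set.range X)) ?_ ?_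
    (Submodule.subset_span ⟨(a, m, n), rfl⟩)
  · intro Y hY
    induction hY using Submodule.span_induction with
    | mem Y hY =>
      obtain ⟨i, rfl⟩ := hY
      exact constTerm_commutatorDefect_one hk _ _ _
    | zero => exact map_zero _
    | add Y Z _ _ hY hZ => rw [LinearMap.add_apply, map_add, hY, hZ, add_zero]
    | smul c Y _ hY => rw [LinearMap.smul_apply, constTerm_smul, hY, mul_zero]
  · intro Y hY r hr
    induction hY using Submodule.span_induction with
    | mem Y hY =>
      obtain ⟨⟨a, m, n⟩, rfl⟩ := hY
      refine ⟨X (a + r, m + r, n) - X (a, m + r, n) + X (a, m, n - r),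
        Submodule.add_mem _ (Submodule.sub_mem _ ?_ ?_) ?_,
        fun f => heisenberg_commutatorDefect hr k a m n f⟩
      all_goals exact Submodule.subset_span ⟨_, rfl⟩
    | zero => exact ⟨0, Submodule.zero_mem _, fun f => by simp⟩
    | add Y Z _ _ hY hZ =>
      obtain ⟨Y', hY', h1⟩ := hY
      obtain ⟨Z', hZ', h2⟩ := hZ
      refine ⟨Y' + Z', Submodule.add_mem _ hY' hZ', fun f => ?_⟩
      simp only [LinearMap.add_apply, map_add, h1, h2]
      abel
    | smul c Y _ hY =>
      obtain ⟨Y', hY', h1⟩ := hY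
      refine ⟨c • Y', Submodule.smul_mem _ c hY', fun f => ?_⟩
      simp only [LinearMap.smul_apply, map_smul, h1, smul_add]

theorem chargedP_B {k : ℕ} (hk : 1 ≤ k) (a m n : ℤ) (f : TPoly) :
    chargedP k a m (B 0 n f) = B 0 n (chargedP k (a - 1) m f) +
      shiftCoeff k (n - m + a - 1) • B 0 (n - m) f := by
  have h := congrArg (fun X : Module.End ℂ TPoly => X f) (commutatorDefect_eq_zero hk a m n)
  rw [commutatorDefect_apply, LinearMap.zero_apply, sub_sub, sub_eq_zero] at h
  exact h

/-! ### Elementary symmetric functions, Pieri's rule and hooks -/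

/-- The signed elementary symmetric function `(-1)^j e_j`, obtained from the complete symmetric
function by the substitution `t ↦ -t`. -/
def signedElementary (j : ℤ) : TPoly :=
  MvPolynomial.aeval (fun n : ℕ+ => -MvPolynomial.X n) (B 0 j 1)

theorem constTerm_aeval_neg (f : TPoly) :
    constTerm (MvPolynomial.aeval (fun n : ℕ+ => (-MvPolynomial.X n : TPoly)) f) = constTerm f := by
  induction f using MvPolynomial.induction_on with
  | C c => rw [MvPolynomial.aeval_C]; rfl
  | add f g hf hg => rw [map_add, map_add, map_add, hf, hg]
  | mul_X f n _ =>
    rw [map_mul, map_mul, map_mul, MvPolynomial.aeval_X, map_neg, MvPolynomial.constantCoeff_X,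
      neg_zero, mul_zero, mul_zero]

theorem pderiv_aeval_neg (s : ℕ+) (f : TPoly) :
    MvPolynomial.pderiv s (MvPolynomial.aeval (fun n : ℕ+ => (-MvPolynomial.X n : TPoly)) f) =
      -MvPolynomial.aeval (fun n : ℕ+ => (-MvPolynomial.X n : TPoly)) (MvPolynomial.pderiv s f) := by
  induction f using MvPolynomial.induction_on with
  | C c =>
    rw [MvPolynomial.aeval_C, MvPolynomial.pderiv_C, map_zero, neg_zero]
    exact MvPolynomial.pderiv_C
  | add f g hf hg => rw [map_add, map_add, map_add, map_add, hf, hg, neg_add]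
  | mul_X f n ih =>
    rw [map_mul, MvPolynomial.aeval_X, Derivation.leibniz, Derivation.leibniz, ih, map_neg,
      MvPolynomial.pderiv_X, Pi.single_apply]
    simp only [smul_eq_mul, map_add, map_mul, MvPolynomial.aeval_X]
    split_ifs
    · simp
      ring
    · simp

theorem constTerm_signedElementary (j : ℤ) :
    constTerm (signedElementary j) = if j = 0 then 1 else 0 := by
  rw [signedElementary, constTerm_aeval_neg, constTerm_B_one]

theorem heisenberg_signedElementary {r : ℤ} (hr : 0 < r) (j : ℤ) :
    heisenberg r (signedElementary j) = -signedElementary (j - r) := by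
  obtain ⟨s, rfl | rfl⟩ := exists_eq_coe_or_neg_coe hr.ne'
  · rw [heisenberg_coe, signedElementary, pderiv_aeval_neg, ← heisenberg_coe, heisenberg_B_one hr,
      signedElementary]
  · omega

theorem signedElementary_of_neg {j : ℤ} (hj : j < 0) : signedElementary j = 0 := by
  rw [signedElementary, B_one_of_neg hj, map_zero]

theorem signedElementary_zero : signedElementary 0 = 1 := by
  rw [signedElementary, B_zero_one, map_one]

theorem natCast_smul_signedElementary (N : ℕ) : (N : ℂ) • signedElementary N =
    ∑ i ∈ Finset.range N, -heisenberg (-(i + 1 : ℤ)) (signedElementary (N - (i + 1))) := by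
  rw [sum_heisenberg_heisenberg (V := fun w => Submodule.span ℂ {signedElementary w}) ?_ ?_
    (Submodule.mem_span_singleton_self _)]
  · refine Finset.sum_congr rfl fun i _ => ?_
    rw [heisenberg_signedElementary (by omega), map_neg]
  · intro w f hf r hr
    obtain ⟨c, rfl⟩ := Submodule.mem_span_singleton.1 hf
    rw [map_smul, heisenberg_signedElementary hr]
    exact Submodule.smul_mem _ _ (Submodule.neg_mem _ (Submodule.mem_span_singleton_self _))
  · intro w hw f hf
    obtain ⟨c, rfl⟩ := Submodule.mem_span_singleton.1 hf
    rw [constTerm_smul, constTerm_signedElementary, if_neg hw, mul_zero]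

/-- In Newton's identity for `j · (-1)^j e_j` each of the `j` summands contributes the same value,
since moving `t_r` out of `B_n` raises `n` by `r` while `j` drops by `r`. -/
theorem constTerm_B_signedElementary (n j : ℤ) :
    constTerm (B 0 n (signedElementary j)) = if 0 ≤ j ∧ n = -j then 1 else 0 := by
  by_cases hj : 0 ≤ j
  swap
  · rw [signedElementary_of_neg (not_le.1 hj), map_zero, map_zero, if_neg (fun h => hj h.1)]
  rw [if_congr (and_iff_right hj) rfl rfl]
  lift j to ℕ using hj
  induction j using Nat.strong_induction_on generalizing n with
  | _ j ih =>
    by_cases hj : j = 0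
    · subst hj
      rw [Nat.cast_zero, signedElementary_zero, constTerm_B_one, neg_zero]
    · have hj' : (j : ℂ) ≠ 0 := by exact_mod_cast hj
      apply mul_left_cancel₀ hj'
      rw [← constTerm_smul, ← map_smul, natCast_smul_signedElementary, map_sum, map_sum]
      rw [Finset.sum_congr rfl (g := fun _ => if n = -j then (1 : ℂ) else 0)]
      · rw [Finset.sum_const, Finset.card_range, nsmul_eq_mul]
      · intro i hi
        have hi := Finset.mem_range.1 hi
        rw [map_neg, map_neg, constTerm_B_heisenberg (by omega), neg_neg,
          show (j : ℤ) - (i + 1) = ((j - (i + 1) : ℕ) : ℤ) by omega, ih _ (by omega)]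
        exact if_congr (by omega) rfl rfl

theorem heisenberg_B_signedElementary {r : ℤ} (hr : 0 < r) (n j : ℤ) :
    heisenberg r (B 0 n (signedElementary j)) =
      B 0 (n - r) (signedElementary j) - B 0 n (signedElementary (j - r)) := by
  rw [heisenberg_B hr.ne', heisenberg_signedElementary hr, map_neg]
  abel

/-- This is straightening of `S_{(n,1^j)}` for `n ≤ 0`. The range `n ≤ 0` is stable under `n ↦ n -
r`, and on it `n = -j` already forces `j ≥ 0`, so the constant terms agree. -/
theorem B_signedElementary_of_nonpos {n : ℤ} (hn : n ≤ 0) (j : ℤ) :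
    B 0 n (signedElementary j) = if n = -j then 1 else 0 := by
  refine sub_eq_zero.1 (eq_zero_of_heisenberg (fun f => f ∈ Submodule.span ℂ
    {f : TPoly | ∃ n ≤ (0 : ℤ), ∃ j, f = B 0 n (signedElementary j) - if n = -j then 1 else 0})
    ?_ ?_ (Submodule.subset_span ⟨n, hn, j, rfl⟩))
  · intro f hf
    induction hf using Submodule.span_induction with
    | mem f hf =>
      obtain ⟨n, hn, j, rfl⟩ := hf
      rw [map_sub, constTerm_B_signedElementary, if_congr (Q := n = -j) (by omega) rfl rfl]
      split_ifs <;> simp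
    | zero => exact map_zero _
    | add f g _ _ hf hg => rw [map_add, hf, hg, add_zero]
    | smul c f _ hf => rw [constTerm_smul, hf, mul_zero]
  · intro f hf r hr
    induction hf using Submodule.span_induction with
    | mem f hf =>
      obtain ⟨n, hn, j, rfl⟩ := hf
      have h : heisenberg r (B 0 n (signedElementary j) - if n = -j then 1 else 0) =
          (B 0 (n - r) (signedElementary j) - if n - r = -j then 1 else 0) -
            (B 0 n (signedElementary (j - r)) - if n = -(j - r) then 1 else 0) := by
        rw [map_sub, heisenberg_B_signedElementary hr,
          if_congr (P := n - r = -j) (Q := n = -(j - r)) (by omega) rfl rfl]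
        have : heisenberg r (if n = -j then 1 else 0) = 0 := by
          split_ifs
          · exact heisenberg_one hr
          · exact map_zero _
        rw [this]
        abel
      rw [h]
      exact Submodule.sub_mem _ (Submodule.subset_span ⟨n - r, by omega, j, rfl⟩)
        (Submodule.subset_span ⟨n, hn, j - r, rfl⟩)
    | zero => rw [map_zero]; exact Submodule.zero_mem _
    | add f g _ _ hf hg => rw [map_add]; exact Submodule.add_mem _ hf hg
    | smul c f _ hf => rw [map_smul]; exact Submodule.smul_mem _ c hf

theorem heisenberg_mul {r : ℤ} (hr : 0 < r) (f g : TPoly) :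
    heisenberg r (f * g) = heisenberg r f * g + f * heisenberg r g := by
  obtain ⟨s, rfl | rfl⟩ := exists_eq_coe_or_neg_coe hr.ne'
  · simp only [heisenberg_coe, Derivation.leibniz, smul_eq_mul]
    ring
  · omega

/-- Pieri's rule for the product of a complete and an elementary symmetric function. -/
theorem signedElementary_mul_B_one (i j : ℤ) :
    signedElementary i * B 0 j 1 =
      B 0 j (signedElementary i) - B 0 (j + 1) (signedElementary (i - 1)) := by
  set y : ℤ × ℤ → TPoly := fun p => signedElementary p.1 * B 0 p.2 1 -
    (B 0 p.2 (signedElementary p.1) - B 0 (p.2 + 1) (signedElementary (p.1 - 1))) with hy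
  refine sub_eq_zero.1 (eq_zero_of_heisenberg (fun f => f ∈ Submodule.span ℂ (Set.range y))
    ?_ ?_ (Submodule.subset_span ⟨(i, j), rfl⟩))
  · intro f hf
    induction hf using Submodule.span_induction with
    | mem f hf =>
      obtain ⟨⟨i, j⟩, rfl⟩ := hf
      rw [hy]
      simp only [map_sub, map_mul, constTerm_signedElementary, constTerm_B_one,
        constTerm_B_signedElementary]
      -- For `i ≠ 0` the conditions `j = -i` and `j + 1 = -(i - 1)` coincide and the right side
      -- cancels; for `i = 0` its second term is absent.
      by_cases hi : i = 0
      · subst hi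
        simp
      · rw [if_neg hi, zero_mul, if_congr (P := 0 ≤ i ∧ j = -i)
          (Q := 0 ≤ i - 1 ∧ j + 1 = -(i - 1)) (by omega) rfl rfl]
        ring
    | zero => exact map_zero _
    | add f g _ _ hf hg => rw [map_add, hf, hg, add_zero]
    | smul c f _ hf => rw [constTerm_smul, hf, mul_zero]
  · intro f hf r hr
    induction hf using Submodule.span_induction with
    | mem f hf =>
      obtain ⟨⟨i, j⟩, rfl⟩ := hf
      have h : heisenberg r (y (i, j)) = y (i, j - r) - y (i - r, j) := by
        simp only [hy, map_sub, heisenberg_mul hr, heisenberg_B_signedElementary hr,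
          heisenberg_signedElementary hr, heisenberg_B_one hr]
        rw [show i - 1 - r = i - r - 1 by ring, show j + 1 - r = j - r + 1 by ring]
        ring
      rw [h]
      exact Submodule.sub_mem _ (Submodule.subset_span ⟨_, rfl⟩) (Submodule.subset_span ⟨_, rfl⟩)
    | zero => rw [map_zero]; exact Submodule.zero_mem _
    | add f g _ _ hf hg => rw [map_add]; exact Submodule.add_mem _ hf hg
    | smul c f _ hf => rw [map_smul]; exact Submodule.smul_mem _ c hf

theorem schur_replicate_one (j : ℕ) :
    schur (List.replicate j 1) = (-1 : ℂ) ^ j • signedElementary j := by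
  induction j with
  | zero => rw [pow_zero, one_smul, Nat.cast_zero, signedElementary_zero]; rfl
  | succ j ih =>
    have h : schur (List.replicate (j + 1) 1) = B 0 1 (schur (List.replicate j 1)) := rfl
    -- Pieri's rule with `h_0 = 1`: the term `B_0` of `e_{j+1}` vanishes by straightening, leaving
    -- the recursion `e_{j+1} = B_1 e_j`.
    have h2 := signedElementary_mul_B_one ((j + 1 : ℕ) : ℤ) 0
    rw [B_zero_one, mul_one, B_signedElementary_of_nonpos le_rfl, if_neg (by push_cast; omega),
      zero_sub, zero_add, Nat.cast_succ, add_sub_cancel_right] at h2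
    rw [h, ih, map_smul, Nat.cast_succ, h2, pow_succ, mul_neg_one, neg_smul, smul_neg, neg_neg]

theorem finite_support_signedElementary_mul (c : ℤ → ℂ) (N : ℤ) :
    (Function.support fun j : ℤ => c j • (signedElementary (N - j) * B 0 j 1)).Finite := by
  refine (Set.finite_Icc 0 N).subset fun j hj => ?_
  by_contra h
  apply hj
  change c j • (signedElementary (N - j) * B 0 j 1) = 0
  by_cases h0 : 0 ≤ j
  · rw [signedElementary_of_neg (j := N - j) (by simp only [Set.mem_Icc] at h; omega), zero_mul,
      smul_zero]
  · rw [B_one_of_neg (not_le.1 h0), mul_zero, smul_zero]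

/-- The sum `∑_j [j + a]_k (-1)^{N-j} e_{N-j} h_j`. -/
def pieriSum (k : ℕ) (a N : ℤ) : TPoly :=
  ∑ᶠ j : ℤ, (fallingFactorial (j + a) k : ℂ) • (signedElementary (N - j) * B 0 j 1)

theorem constTerm_pieriSum (k : ℕ) (a N : ℤ) :
    constTerm (pieriSum k a N) = if -N = 0 then (fallingFactorial a k : ℂ) else 0 := by
  have h1 := AddMonoidHom.map_finsum constTerm.toAddMonoidHom
    (finite_support_signedElementary_mul (fun j => (fallingFactorial (j + a) k : ℂ)) N)
  refine h1.trans ?_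
  change ∑ᶠ j : ℤ, constTerm
    ((fallingFactorial (j + a) k : ℂ) • (signedElementary (N - j) * B 0 j 1)) = _
  simp only [constTerm_smul, map_mul, constTerm_signedElementary, constTerm_B_one]
  rw [finsum_eq_single _ 0]
  · rw [if_pos rfl, mul_one, sub_zero, zero_add, mul_ite, mul_one, mul_zero]
    exact if_congr (by omega) rfl rfl
  · intro j hj
    rw [if_neg hj, mul_zero, mul_zero]

theorem heisenberg_pieriSum {r : ℤ} (hr : 0 < r) (k : ℕ) (a N : ℤ) :
    heisenberg r (pieriSum k a N) = pieriSum k (a + r) (N - r) - pieriSum k a (N - r) := by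
  have h1 := AddMonoidHom.map_finsum (heisenberg r).toAddMonoidHom
    (finite_support_signedElementary_mul (fun j => (fallingFactorial (j + a) k : ℂ)) N)
  have h2 : pieriSum k (a + r) (N - r) = ∑ᶠ j : ℤ,
      (fallingFactorial (j + a) k : ℂ) • (signedElementary (N - j) * B 0 (j - r) 1) := by
    rw [pieriSum, ← finsum_comp_equiv (Equiv.subRight r)]
    refine finsum_congr fun j => ?_
    rw [Equiv.subRight_apply, show j - r + (a + r) = j + a by ring,
      show N - r - (j - r) = N - j by ring]
  have hfin : (Function.support fun j : ℤ => (fallingFactorial (j + a) k : ℂ) •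
      (signedElementary (N - j) * B 0 (j - r) 1)).Finite := by
    refine ((finite_support_signedElementary_mul
      (fun j => (fallingFactorial (j + r + a) k : ℂ)) (N - r)).image (· + r)).subset ?_
    intro j hj
    refine ⟨j - r, ?_, sub_add_cancel j r⟩
    rw [Function.mem_support, sub_add_cancel, sub_sub_sub_cancel_right]
    exact hj
  have h3 : pieriSum k a (N - r) = ∑ᶠ j : ℤ,
      (fallingFactorial (j + a) k : ℂ) • (signedElementary (N - r - j) * B 0 j 1) := rfl
  rw [h2, h3,
    ← finsum_sub_distrib hfin (finite_support_signedElementary_mul _ _)]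
  refine h1.trans (finsum_congr fun j => ?_)
  rw [LinearMap.toAddMonoidHom_coe, map_smul, heisenberg_mul hr, heisenberg_signedElementary hr,
    heisenberg_B_one hr, ← smul_sub, show N - j - r = N - r - j by ring, neg_mul,
    neg_add_eq_sub]

/-- The action of `chargedP` on the vacuum, in terms of products of elementary and complete
symmetric functions. -/
theorem chargedP_one_eq_pieriSum (k : ℕ) (a N : ℤ) : chargedP k a (-N) 1 = pieriSum k a N := by
  -- The formula comes from `(∂_z + J + a z⁻¹)^k 1 = z^{-a} e^{-φ} ∂_z^k (z^a e^φ)` at `p = 0`, with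
  -- `φ = ∑ t_n z^n`, `e^φ = ∑ h_j z^j` and `e^{-φ} = ∑ (-1)^i e_i z^i`. It is verified by comparing
  -- constant terms and derivatives.
  refine sub_eq_zero.1 (eq_zero_of_heisenberg (fun f => f ∈ Submodule.span ℂ
    (Set.range fun p : ℤ × ℤ => chargedP k p.1 (-p.2) 1 - pieriSum k p.1 p.2))
    ?_ ?_ (Submodule.subset_span ⟨(a, N), rfl⟩))
  · intro f hf
    induction hf using Submodule.span_induction with
    | mem f hf =>
      obtain ⟨⟨a, N⟩, rfl⟩ := hf
      rw [map_sub, constTerm_pieriSum, constTerm_chargedP_one, sub_self]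
    | zero => exact map_zero _
    | add f g _ _ hf hg => rw [map_add, hf, hg, add_zero]
    | smul c f _ hf => rw [constTerm_smul, hf, mul_zero]
  · intro f hf r hr
    induction hf using Submodule.span_induction with
    | mem f hf =>
      obtain ⟨⟨a, N⟩, rfl⟩ := hf
      have h : heisenberg r (chargedP k a (-N) 1 - pieriSum k a N) =
          (chargedP k (a + r) (-(N - r)) 1 - pieriSum k (a + r) (N - r)) -
            (chargedP k a (-(N - r)) 1 - pieriSum k a (N - r)) := by
        rw [map_sub, heisenberg_chargedP_one hr, heisenberg_pieriSum hr,
          show -N + r = -(N - r) by ring]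
        abel
      rw [h]
      exact Submodule.sub_mem _ (Submodule.subset_span ⟨(a + r, N - r), rfl⟩)
        (Submodule.subset_span ⟨(a, N - r), rfl⟩)
    | zero => rw [map_zero]; exact Submodule.zero_mem _
    | add f g _ _ hf hg => rw [map_add]; exact Submodule.add_mem _ hf hg
    | smul c f _ hf => rw [map_smul]; exact Submodule.smul_mem _ c hf

/-- The action of `chargedP` on the vacuum, in terms of hooks. -/
theorem chargedP_one_eq_sum {k : ℕ} (hk : 1 ≤ k) (a : ℤ) {N : ℤ} (hN : 0 < N) :
    chargedP k a (-N) 1 = ∑ n ∈ Finset.Icc 1 N,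
      shiftCoeff k (n + a - 1) • B 0 n (signedElementary (N - n)) := by
  -- For `n ≤ 0` straightening leaves only `n = -(N - n)`, which would force `N = 0`. Hence
  -- summation by parts has no boundary terms.
  have hzero (n : ℤ) (hn : n ∉ Finset.Icc 1 N) : B 0 n (signedElementary (N - n)) = 0 := by
    rw [Finset.mem_Icc] at hn
    by_cases h : n ≤ 0
    · rw [B_signedElementary_of_nonpos h, if_neg (by omega)]
    · rw [signedElementary_of_neg (by omega), map_zero]
  have hfin (c : ℤ → ℂ) :
      (Function.support fun n : ℤ => c n • B 0 n (signedElementary (N - n))) ⊆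
        (Finset.Icc 1 N : Finset ℤ) := by
    intro n hn
    by_contra h
    apply hn
    change c n • B 0 n (signedElementary (N - n)) = 0
    rw [hzero n h, smul_zero]
  have hfin' (c : ℤ → ℂ) := (Finset.finite_toSet _).subset (hfin c)
  -- Summation by parts: shifting `n` trades the difference of falling factorials for the difference
  -- of hooks in Pieri's rule.
  have hshift : ∑ᶠ n : ℤ, (fallingFactorial (n - 1 + a) k : ℂ) • B 0 n (signedElementary (N - n)) =
      ∑ᶠ n : ℤ, (fallingFactorial (n + a) k : ℂ) • B 0 (n + 1) (signedElementary (N - n - 1)) := by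
    rw [← finsum_comp_equiv (Equiv.addRight (1 : ℤ))]
    refine finsum_congr fun n => ?_
    change (fallingFactorial (n + 1 - 1 + a) k : ℂ) •
      B 0 (n + 1) (signedElementary (N - (n + 1))) = _
    rw [add_sub_cancel_right, sub_add_eq_sub_sub]
  have hfin2 : (Function.support fun n : ℤ => (fallingFactorial (n + a) k : ℂ) •
      B 0 (n + 1) (signedElementary (N - n - 1))).Finite := by
    refine ((hfin' fun n => (fallingFactorial (n - 1 + a) k : ℂ)).image (· - 1)).subset ?_
    intro n hn
    refine ⟨n + 1, ?_, add_sub_cancel_right n 1⟩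
    change (fallingFactorial (n + 1 - 1 + a) k : ℂ) •
      B 0 (n + 1) (signedElementary (N - (n + 1))) ≠ 0
    rw [add_sub_cancel_right, sub_add_eq_sub_sub]
    exact hn
  rw [← finsum_eq_sum_of_support_subset _ (hfin fun n => shiftCoeff k (n + a - 1)),
    chargedP_one_eq_pieriSum, pieriSum]
  have h1 (n : ℤ) : shiftCoeff k (n + a - 1) • B 0 n (signedElementary (N - n)) =
      (fallingFactorial (n + a) k : ℂ) • B 0 n (signedElementary (N - n)) -
        (fallingFactorial (n - 1 + a) k : ℂ) • B 0 n (signedElementary (N - n)) := by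
    rw [shiftCoeff_eq hk, sub_add_cancel, sub_smul, show n - 1 + a = n + a - 1 by ring]
  rw [finsum_congr h1, finsum_sub_distrib (hfin' _) (hfin' _), hshift,
    ← finsum_sub_distrib (hfin' _) hfin2]
  refine finsum_congr fun n => ?_
  rw [signedElementary_mul_B_one, smul_sub]

/-! ### Products of vertex operators and the final formula -/

/-- The product `B_{λ_1} ⋯ B_{λ_l}`. -/
def vertexProduct (lam : List ℤ) : Module.End ℂ TPoly := (lam.map (B 0)).prod

theorem vertexProduct_cons (n : ℤ) (lam : List ℤ) (f : TPoly) :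
    vertexProduct (n :: lam) f = B 0 n (vertexProduct lam f) := by
  rw [vertexProduct, List.map_cons, List.prod_cons]
  rfl

theorem schur_cons (n : ℤ) (lam : List ℤ) : schur (n :: lam) = B 0 n (schur lam) := rfl

theorem schur_append (lam mu : List ℤ) : schur (lam ++ mu) = vertexProduct lam (schur mu) := by
  induction lam with
  | nil => rfl
  | cons n lam ih => rw [List.cons_append, schur_cons, ih, vertexProduct_cons]

theorem vertexProduct_one (lam : List ℤ) : vertexProduct lam 1 = schur lam := by
  have h := (schur_append lam []).symm
  rwa [List.append_nil] at h

/-- Iteration of `chargedP_B`. The charge drops by one at each factor; with zero-based `i`, the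
shift `i + 1` is the charge `a - i` together with the `-1` in the relation. -/
theorem chargedP_vertexProduct {k : ℕ} (hk : 1 ≤ k) (m : ℤ) (f : TPoly) {l : ℕ} (lam : Fin l → ℤ)
    (a : ℤ) : chargedP k a m (vertexProduct (List.ofFn lam) f) =
      (∑ i : Fin l, shiftCoeff k (lam i - m + a - ((i : ℕ) + 1 : ℤ)) •
        vertexProduct (List.ofFn (lam - Pi.single i m)) f) +
      vertexProduct (List.ofFn lam) (chargedP k (a - l) m f) := by
  induction l generalizing a with
  | zero =>
    simp [vertexProduct]
  | succ l ih =>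
    have h0 : List.ofFn (lam - Pi.single 0 m) =
        (lam 0 - m) :: List.ofFn fun i : Fin l => lam i.succ := by
      rw [List.ofFn_succ]
      simp
    have hs (i : Fin l) : List.ofFn (lam - Pi.single i.succ m) =
        lam 0 :: List.ofFn ((fun i : Fin l => lam i.succ) - Pi.single i m) := by
      rw [List.ofFn_succ]
      congr 1
      · simp [Ne.symm (Fin.succ_ne_zero i)]
      · congr 1
        funext j
        simp [Pi.single_apply]
    rw [List.ofFn_succ, vertexProduct_cons, chargedP_B hk, ih, map_add, map_sum, Fin.sum_univ_succ,
      h0, vertexProduct_cons, vertexProduct_cons]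
    have hsum : ∑ i : Fin l, B 0 (lam 0)
        (shiftCoeff k (lam i.succ - m + (a - 1) - ((i : ℕ) + 1 : ℤ)) •
          vertexProduct (List.ofFn ((fun i : Fin l => lam i.succ) - Pi.single i m)) f) =
        ∑ i : Fin l, shiftCoeff k (lam i.succ - m + a - (((i.succ : Fin (l + 1)) : ℕ) + 1 : ℤ)) •
          vertexProduct (List.ofFn (lam - Pi.single i.succ m)) f := by
      refine Finset.sum_congr rfl fun i _ => ?_
      rw [map_smul, hs, vertexProduct_cons, Fin.val_succ]
      congr 2
      push_cast
      ring
    rw [hsum, show a - ((l + 1 : ℕ) : ℤ) = a - 1 - l by push_cast; ring, Fin.val_zero,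
      Nat.cast_zero, zero_add]
    abel

end WSchur

end

theorem theorem1p2 (k : ℕ) (hk : 1 ≤ k) (m : ℤ) (l : ℕ) (lam : Fin l → ℤ) :
    WSchur.P 0 k m (WSchur.schur (List.ofFn lam)) =
      (∑ i : Fin l,
        ((k : ℂ) * (WSchur.fallingFactorial (lam i - m - ((i : ℕ) + 1 : ℤ)) (k - 1) : ℂ)) •
          WSchur.schur (List.ofFn (lam - Pi.single i m))) +
      (if m = 0 then
        (WSchur.fallingFactorial (-(l : ℤ)) k : ℂ) • WSchur.schur (List.ofFn lam) else 0) +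
      (if m < 0 then
        ∑ n ∈ Finset.Icc (1 : ℤ) (-m),
          ((-1 : ℂ) ^ (m - n) * (k : ℂ) *
              (WSchur.fallingFactorial (n - (l : ℤ) - 1) (k - 1) : ℂ)) •
            WSchur.schur (List.ofFn lam ++ n :: List.replicate (-m - n).toNat 1) else 0) := by
  rw [WSchur.P_eq_chargedP hk, ← WSchur.vertexProduct_one, WSchur.chargedP_vertexProduct hk,
    add_assoc]
  congr 1
  · refine Finset.sum_congr rfl fun i _ => ?_
    rw [WSchur.vertexProduct_one, add_zero]
    rfl
  rw [zero_sub]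
  rcases lt_trichotomy m 0 with hm | rfl | hm
  · rw [if_neg hm.ne, if_pos hm, zero_add]
    have h := WSchur.chargedP_one_eq_sum hk (-(l : ℤ)) (neg_pos.2 hm)
    rw [neg_neg] at h
    rw [h, map_sum]
    refine Finset.sum_congr rfl fun n hn => ?_
    rw [Finset.mem_Icc] at hn
    obtain ⟨j, hj⟩ := Int.eq_ofNat_of_zero_le (sub_nonneg.2 hn.2)
    rw [WSchur.schur_append, WSchur.schur_cons, hj, Int.toNat_natCast,
      WSchur.schur_replicate_one, map_smul, map_smul, map_smul, smul_smul]
    congr 1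
    -- Since `j = -m - n`, the exponents `m - n` and `j` have equal parity, so the stated sign
    -- cancels the sign in `S_{(1^j)} = (-1)^j · (-1)^j e_j`.
    have h1 : m - n = j + 2 * (-(j + n)) + 2 * 0 := by omega
    have h2 : (-1 : ℂ) ^ (m - n) = (-1) ^ j := by
      rw [h1, mul_zero, add_zero, zpow_add₀ (by norm_num), zpow_mul, zpow_natCast]
      norm_num
    have h3 : ((-1 : ℂ) ^ j) * (-1) ^ j = 1 := by
      rw [← mul_pow]
      norm_num
    rw [h2, WSchur.shiftCoeff, ← sub_eq_add_neg]
    linear_combination -(k * (WSchur.fallingFactorial (n - l - 1) (k - 1) : ℂ)) * h3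
  · rw [if_pos rfl, if_neg (lt_irrefl _), add_zero, WSchur.chargedP_zero_one,
      ← mul_one (MvPolynomial.C _), ← MvPolynomial.smul_eq_C_mul, map_smul]
  · rw [if_neg hm.ne', if_neg hm.not_gt, WSchur.chargedP_one_of_pos _ _ hm, map_zero, add_zero]
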